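/- Let $(M,g)$ be an oriented smooth four-dimensional spacetime of signature $(-+++)$, with Levi-Civita connection $\nabla$, metric volume element $\eta$ and Hodge dual $*$. Let $\delta = *d*$ be the codifferential on 2-forms (so that $(\delta F)_\beta = -\nabla^\alpha F_{\alpha\beta}$). For a 1-form $v$, let $i(v)$ denote contraction of the vector $v^\mu$ with the first index, e.g. $(i(v)F)_\beta = v^\mu F_{\mu\beta}$. Let $U$ be a smooth unitary 2-form that is at each point the volume element of a time-like plane, i.e. $U = t\wedge s$ with $g(t,t)=-1$, $g(s,s)=1$, $g(t,s)=0$. Let $\phi,\psi$ be smooth functions on $M$, and let $$A = e^{\phi}\,[\cos\psi\, U + \sin\psi\, {*U}]$$ be the non-null (regular) skew-symmetric tensor with canonical elements $(U,\phi,\psi)$. Put $\mathcal U = \frac{1}{\sqrt 2}(U - \mathrm{i}\,{*U})$ and $\mathcal G = \frac12 (G - \mathrm{i}\,\eta)$, where $G_{\alpha\beta\mu\nu} = g_{\alpha\mu}g_{\beta\nu} - g_{\alpha\nu}g_{\beta\mu}$. Then $A$ satisfies the Killing-Yano equation $\nabla_{(\alpha}A_{\beta)\mu} = 0$ on $M$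 if and only if the following four equations hold on $M$: $$\Sigma[U] \equiv \nabla\mathcal U - i(\delta\mathcal U)\,\mathcal U\otimes\mathcal U - i(\delta\mathcal U)\,\mathcal G = 0,$$ $$-2\,d\phi = \Phi[U] \equiv i(\delta U)U - i(\delta {*U}){*U},$$ $$-2\,d\psi = \Psi[U] \equiv -\,i(\delta U){*U} - i(\delta {*U})U,$$ $$\cos\psi\,\delta U + \sin\psi\,\delta {*U} = 0.$$ -/

import Mathlib

open scoped Manifold ContDiff

noncomputable section

namespace Spacetime

/-- The model space `ℝ⁴`. -/
abbrev E4 : Type := EuclideanSpace ℝ (Fin 4)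

/-! ### Tensor algebra on components

Pointwise formulas in a positively oriented coordinate system.  `G` is the matrix of covariant
components `g_{ij}` at the point.  The index order of a component array is the index order of the
tensor. -/

section Algebra

variable {V : Type*} [AddCommGroup V] [Module ℝ V]
variable {R : Type*} [CommRing R] [Algebra ℝ R]

/-- The Levi-Civita symbol `ε_{ijkl}`, with `ε_{0123} = 1`. -/
def levi (i j k l : Fin 4) : ℝ :=
  Matrix.det (Matrix.of ![Pi.single i 1, Pi.single j 1, Pi.single k 1, Pi.single l 1] :
    Matrix (Fin 4) (Fin 4) ℝ)

/-- The metric volume element `η_{ijkl} = √|det g| ε_{ijkl}`. -/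
def eta (G : Matrix (Fin 4) (Fin 4) ℝ) (i j k l : Fin 4) : ℝ :=
  Real.sqrt |G.det| * levi i j k l

/-- Index raising for a covector, `v^i = g^{ij} v_j`. -/
def raise1 (G : Matrix (Fin 4) (Fin 4) ℝ) (v : Fin 4 → V) (i : Fin 4) : V :=
  ∑ j, (G⁻¹ i j) • v j

/-- Index raising for a covariant 2-tensor, `F^{ij} = g^{ia} g^{jb} F_{ab}`. -/
def raise2 (G : Matrix (Fin 4) (Fin 4) ℝ) (F : Fin 4 → Fin 4 → V) (i j : Fin 4) : V :=
  ∑ a, ∑ b, (G⁻¹ i a * G⁻¹ j b) • F a b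

/-- Index raising for a covariant 3-tensor, `C^{ijk} = g^{ia} g^{jb} g^{kc} C_{abc}`. -/
def raise3 (G : Matrix (Fin 4) (Fin 4) ℝ) (C : Fin 4 → Fin 4 → Fin 4 → V) (i j k : Fin 4) : V :=
  ∑ a, ∑ b, ∑ c, (G⁻¹ i a * G⁻¹ j b * G⁻¹ k c) • C a b c

/-- Hodge dual of a 2-form, `(*F)_{kl} = (1/2!) F^{ij} η_{ijkl}`. -/
def hodge2 (G : Matrix (Fin 4) (Fin 4) ℝ) (F : Fin 4 → Fin 4 → V) (k l : Fin 4) : V :=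
  (1 / 2 : ℝ) • ∑ i, ∑ j, eta G i j k l • raise2 G F i j

/-- Hodge dual of a 3-form, `(*C)_l = (1/3!) C^{ijk} η_{ijkl}`. -/
def hodge3 (G : Matrix (Fin 4) (Fin 4) ℝ) (C : Fin 4 → Fin 4 → Fin 4 → V) (l : Fin 4) : V :=
  (1 / 6 : ℝ) • ∑ i, ∑ j, ∑ k, eta G i j k l • raise3 G C i j k

/-- Interior product of (the vector dual to) a covector with a 2-form,
`(i(v)F)_k = v^m F_{mk}`. -/
def inter2 (G : Matrix (Fin 4) (Fin 4) ℝ) (v : Fin 4 → R) (F : Fin 4 → Fin 4 → R) (k : Fin 4) : R :=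
  ∑ m, raise1 G v m * F m k

/-- Interior product of (the vector dual to) a covector with a double 2-form,
`(i(v)Q)_{kij} = v^m Q_{mkij}`. -/
def inter4 (G : Matrix (Fin 4) (Fin 4) ℝ) (v : Fin 4 → R) (Q : Fin 4 → Fin 4 → Fin 4 → Fin 4 → R)
    (k i j : Fin 4) : R :=
  ∑ m, raise1 G v m * Q m k i j

/-- The metric on 2-forms, `G = ½ g ∧ g`, i.e. `G_{abmn} = g_{am} g_{bn} - g_{an} g_{bm}`. -/
def metric2 (G : Matrix (Fin 4) (Fin 4) ℝ) (a b m n : Fin 4) : ℝ :=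
  G a m * G b n - G a n * G b m

/-- The metric on self-dual 2-forms, `𝒢 = ½ (G - i η)`. -/
def selfDualMetric (G : Matrix (Fin 4) (Fin 4) ℝ) (a b m n : Fin 4) : ℂ :=
  (1 / 2 : ℂ) * ((metric2 G a b m n : ℂ) - Complex.I * (eta G a b m n : ℂ))

end Algebra

/-! ### First order tensor calculus in coordinates

`g : E4 → Matrix (Fin 4) (Fin 4) ℝ` gives the metric components as functions of the coordinates. -/

section Calculus

variable {V : Type*} [NormedAddCommGroup V] [NormedSpace ℝ V]

/-- The partial derivative `∂_k f` at `y`. -/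
def pd (k : Fin 4) (f : E4 → V) (y : E4) : V :=
  fderiv ℝ f y (EuclideanSpace.single k 1)

/-- The Christoffel symbols `Γ^l_{ij} = ½ g^{lm} (∂_i g_{mj} + ∂_j g_{mi} - ∂_m g_{ij})` of the
Levi-Civita connection. -/
def christoffel (g : E4 → Matrix (Fin 4) (Fin 4) ℝ) (y : E4) (l i j : Fin 4) : ℝ :=
  (1 / 2) * ∑ m, (g y)⁻¹ l m *
    (pd i (fun z => g z m j) y + pd j (fun z => g z m i) y - pd m (fun z => g z i j) y)

/-- The covariant derivative `(∇T)_{kij} = ∇_k T_{ij}` of a covariant 2-tensor. -/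
def nabla (g : E4 → Matrix (Fin 4) (Fin 4) ℝ) (T : E4 → Fin 4 → Fin 4 → V) (y : E4)
    (k i j : Fin 4) : V :=
  pd k (fun z => T z i j) y
    - ∑ l, christoffel g y l k i • T y l j - ∑ l, christoffel g y l k j • T y i l

/-- The exterior derivative of a 2-form, `(dF)_{ijk} = ∂_i F_{jk} + ∂_j F_{ki} + ∂_k F_{ij}`. -/
def extd2 (F : E4 → Fin 4 → Fin 4 → V) (y : E4) (i j k : Fin 4) : V :=
  pd i (fun z => F z j k) y + pd j (fun z => F z k i) y + pd k (fun z => F z i j) y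

/-- The Hodge dual of a field of 2-forms. -/
def star (g : E4 → Matrix (Fin 4) (Fin 4) ℝ) (F : E4 → Fin 4 → Fin 4 → V) (y : E4) :
    Fin 4 → Fin 4 → V :=
  hodge2 (g y) (F y)

/-- The exterior codifferential of a 2-form, `δ = * d *`. -/
def codiff (g : E4 → Matrix (Fin 4) (Fin 4) ℝ) (F : E4 → Fin 4 → Fin 4 → V) (y : E4) :
    Fin 4 → V :=
  hodge3 (g y) (extd2 (star g F) y)

/-- The self-dual 2-form `𝒰 = (1/√2) (U - i *U)` associated with a real 2-form `U`. -/
def selfDual (g : E4 → Matrix (Fin 4) (Fin 4) ℝ) (U : E4 → Fin 4 → Fin 4 → ℝ) (y : E4)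
    (i j : Fin 4) : ℂ :=
  (1 / (Real.sqrt 2 : ℂ)) * ((U y i j : ℂ) - Complex.I * ((star g U y i j : ℝ) : ℂ))

/-- `Φ[U] = i(δU)U - i(δ*U)*U`. -/
def Phi (g : E4 → Matrix (Fin 4) (Fin 4) ℝ) (U : E4 → Fin 4 → Fin 4 → ℝ) (y : E4) (k : Fin 4) : ℝ :=
  inter2 (g y) (codiff g U y) (U y) k
    - inter2 (g y) (codiff g (star g U) y) (star g U y) k

/-- `Ψ[U] = - i(δU)*U - i(δ*U)U`. -/
def Psi (g : E4 → Matrix (Fin 4) (Fin 4) ℝ) (U : E4 → Fin 4 → Fin 4 → ℝ) (y : E4) (k : Fin 4) : ℝ :=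
  - inter2 (g y) (codiff g U y) (star g U y) k
    - inter2 (g y) (codiff g (star g U) y) (U y) k

/-- `Σ[U] = ∇𝒰 - i(δ𝒰)𝒰 ⊗ 𝒰 - i(δ𝒰)𝒢`. -/
def Sigma (g : E4 → Matrix (Fin 4) (Fin 4) ℝ) (U : E4 → Fin 4 → Fin 4 → ℝ) (y : E4)
    (k i j : Fin 4) : ℂ :=
  nabla g (selfDual g U) y k i j
    - inter2 (g y) (codiff g (selfDual g U) y) (selfDual g U y) k * selfDual g U y i j
    - inter4 (g y) (codiff g (selfDual g U) y) (selfDualMetric (g y)) k i j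

end Calculus

/-! ### Spacetimes and their tensor fields -/

section Manifold

variable (M : Type*) [TopologicalSpace M] [ChartedSpace E4 M] [IsManifold (𝓡 4) ∞ M]

/-- A smooth metric tensor of signature `(-+++)` on `M`. -/
structure LorentzMetric where
  val (p : M) : TangentSpace (𝓡 4) p →L[ℝ] TangentSpace (𝓡 4) p →L[ℝ] ℝ
  symm (p : M) (v w : TangentSpace (𝓡 4) p) : val p v w = val p w v
  signature (p : M) : ∃ b : Module.Basis (Fin 4) ℝ (TangentSpace (𝓡 4) p),
    ∀ i j, val p (b i) (b j) = if i = j then (if i = 0 then -1 else 1) else 0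
  contMDiff : ContMDiff (𝓡 4) ((𝓡 4).prod 𝓘(ℝ, E4 →L[ℝ] E4 →L[ℝ] ℝ)) ∞
    (fun p => Bundle.TotalSpace.mk' (E4 →L[ℝ] E4 →L[ℝ] ℝ)
      (E := fun p => TangentSpace (𝓡 4) p →L[ℝ] TangentSpace (𝓡 4) p →L[ℝ] ℝ) p (val p))

/-- A smooth skew-symmetric covariant 2-tensor (a 2-form) on `M`. -/
structure TwoForm where
  val (p : M) : TangentSpace (𝓡 4) p →L[ℝ] TangentSpace (𝓡 4) p →L[ℝ] ℝ
  skew (p : M) (v w : TangentSpace (𝓡 4) p) : val p v w = - val p w v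
  contMDiff : ContMDiff (𝓡 4) ((𝓡 4).prod 𝓘(ℝ, E4 →L[ℝ] E4 →L[ℝ] ℝ)) ∞
    (fun p => Bundle.TotalSpace.mk' (E4 →L[ℝ] E4 →L[ℝ] ℝ)
      (E := fun p => TangentSpace (𝓡 4) p →L[ℝ] TangentSpace (𝓡 4) p →L[ℝ] ℝ) p (val p))

/-- An orientation of `M`: an atlas of smooth charts whose coordinate changes have positive
Jacobian determinant.  Its members are the positively oriented charts that are used. -/
structure OrientedAtlas where
  charts : Set (OpenPartialHomeomorph M E4)
  smooth : charts ⊆ IsManifold.maximalAtlas (𝓡 4) ∞ M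
  cover (p : M) : ∃ e ∈ charts, p ∈ e.source
  pos : ∀ e ∈ charts, ∀ e' ∈ charts, ∀ y ∈ (e.symm.trans e').source,
    0 < LinearMap.det ((fderiv ℝ (e.symm.trans e') y : E4 →L[ℝ] E4) : E4 →ₗ[ℝ] E4)

variable {M}

/-- The coordinate vector `∂_i` of the chart `e` at the point with coordinates `y`. -/
def coordVec (e : OpenPartialHomeomorph M E4) (y : E4) (i : Fin 4) :
    TangentSpace (𝓡 4) (e.symm y) :=
  mfderiv (𝓡 4) (𝓡 4) e.symm y (EuclideanSpace.single i (1 : ℝ) : E4)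

/-- The components `g_{ij}` of the metric in the chart `e`. -/
def LorentzMetric.comp (g : LorentzMetric M) (e : OpenPartialHomeomorph M E4) (y : E4) :
    Matrix (Fin 4) (Fin 4) ℝ :=
  Matrix.of fun i j => g.val (e.symm y) (coordVec e y i) (coordVec e y j)

/-- The components `F_{ij}` of a 2-form in the chart `e`. -/
def TwoForm.comp (F : TwoForm M) (e : OpenPartialHomeomorph M E4) (y : E4) (i j : Fin 4) : ℝ :=
  F.val (e.symm y) (coordVec e y i) (coordVec e y j)

/-- `U` is the canonical unitary 2-form of a 2+2 almost-product structure, i.e. at every point it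
is the volume element `t ∧ s` of a time-like plane (with orthonormal basis `t`, `s`). -/
def IsCanonicalUnitary (g : LorentzMetric M) (U : TwoForm M) : Prop :=
  ∀ p : M, ∃ t s : TangentSpace (𝓡 4) p,
    g.val p t t = -1 ∧ g.val p s s = 1 ∧ g.val p t s = 0 ∧
    ∀ v w : TangentSpace (𝓡 4) p,
      U.val p v w = g.val p t v * g.val p s w - g.val p s v * g.val p t w

/-- `(U, φ, ψ)` are canonical elements of the non-null skew-symmetric tensor `A`:
`A = e^φ (cos ψ U + sin ψ *U)`, with `U` a canonical unitary 2-form and `φ`, `ψ` smooth. -/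
structure HasCanonicalElements (g : LorentzMetric M) (O : OrientedAtlas M) (A U : TwoForm M)
    (φ ψ : M → ℝ) : Prop where
  unitary : IsCanonicalUnitary g U
  smooth_phi : ContMDiff (𝓡 4) 𝓘(ℝ) ∞ φ
  smooth_psi : ContMDiff (𝓡 4) 𝓘(ℝ) ∞ ψ
  eq : ∀ e ∈ O.charts, ∀ y ∈ e.target, ∀ i j,
    A.comp e y i j = Real.exp (φ (e.symm y)) *
      (Real.cos (ψ (e.symm y)) * U.comp e y i j
        + Real.sin (ψ (e.symm y)) * star (g.comp e) (U.comp e) y i j)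

/-- The Killing-Yano equation `∇_{(i} A_{j)k} = 0`. -/
def IsKillingYano (g : LorentzMetric M) (O : OrientedAtlas M) (A : TwoForm M) : Prop :=
  ∀ e ∈ O.charts, ∀ y ∈ e.target, ∀ i j k,
    (1 / 2 : ℝ) * (nabla (g.comp e) (A.comp e) y i j k + nabla (g.comp e) (A.comp e) y j i k) = 0

/-- `Σ[U] = 0`. -/
def SigmaVanishes (g : LorentzMetric M) (O : OrientedAtlas M) (U : TwoForm M) : Prop :=
  ∀ e ∈ O.charts, ∀ y ∈ e.target, ∀ k i j, Sigma (g.comp e) (U.comp e) y k i j = 0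

/-- `-2 dφ = Φ[U]`. -/
def PhiEquation (g : LorentzMetric M) (O : OrientedAtlas M) (U : TwoForm M) (φ : M → ℝ) : Prop :=
  ∀ e ∈ O.charts, ∀ y ∈ e.target, ∀ k,
    -2 * pd k (fun z => φ (e.symm z)) y = Phi (g.comp e) (U.comp e) y k

/-- `-2 dψ = Ψ[U]`. -/
def PsiEquation (g : LorentzMetric M) (O : OrientedAtlas M) (U : TwoForm M) (ψ : M → ℝ) : Prop :=
  ∀ e ∈ O.charts, ∀ y ∈ e.target, ∀ k,
    -2 * pd k (fun z => ψ (e.symm z)) y = Psi (g.comp e) (U.comp e) y k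

/-- `cos ψ δU + sin ψ δ*U = 0`. -/
def CodiffEquation (g : LorentzMetric M) (O : OrientedAtlas M) (U : TwoForm M) (ψ : M → ℝ) :
    Prop :=
  ∀ e ∈ O.charts, ∀ y ∈ e.target, ∀ k,
    Real.cos (ψ (e.symm y)) * codiff (g.comp e) (U.comp e) y k
      + Real.sin (ψ (e.symm y)) * codiff (g.comp e) (star (g.comp e) (U.comp e)) y k = 0

end Manifold

end Spacetime

end

open scoped Manifold ContDiff

noncomputable section

namespace Spacetime

/-! Because `**F = -F` on 2-forms in Lorentzian signature, the complex form `A - i *A` equals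
`e^{φ+iψ} (U - i *U)`. The two scalars thus become one complex factor, and `∇(A - i *A) = √2
e^{φ+iψ} (λ ⊗ 𝒰 + ∇𝒰)` with `λ = dφ + i dψ`, since `∇` commutes with `*`.

The Killing-Yano equation says that `∇A` is totally skew. In dimension four this is equivalent to
`δA = 0` together with the conformal Killing-Yano equation `∇(A - i *A) = (2/3) i(δ(A - i *A)) 𝒢`
(`killingYano_iff`). The forward direction is Schouten's identity: a totally skew 3-tensor is dual
to a single covector (`hod_eq_wedgeMetric`).

After substitution, with `d = δ𝒰`, the conformal equation is `λ ⊗ 𝒰 + ∇𝒰 = (2/3) i(d - i(λ)𝒰) 𝒢`.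
Contracting with `𝒰` separates it (`conformalKilling_iff`): `𝒰·𝒰 = -2`, `𝒰·∇𝒰 = 0`, `𝒰·i(v)𝒢 = 2
i(v)𝒰`, and contracting twice with `𝒰` multiplies by `1/2`. The result is `λ = -i(d)𝒰`, whose real
and imaginary parts are the equations for `dφ` and `dψ`. Putting this back leaves `Σ[U] = 0`. Under
the same relation `δA` is `3/2` times `e^φ (cos ψ δU + sin ψ δ*U)`, which gives the fourth equation.

The argument is pointwise (`UnitaryJet.killingYano_iff`): it needs only the values of `g`, `U`,
`∇U`, `dφ`, `dψ`. The analytic input is that `∇` commutes with `*` (`nablaMat_hod`), that `* d *` is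
minus the divergence (`codiff_eq_codiv`), and that differentiating the constant norms of `U` gives
`𝒰·∇𝒰 = 0`. -/

/-- Real `4 × 4` matrices. -/
abbrev Mat := Matrix (Fin 4) (Fin 4) ℝ

/-! ### Flat duality of bivectors. -/

/-- The Levi-Civita symbol as an integer. -/
def leviInt (i j k l : Fin 4) : ℤ :=
  (((j : ℤ) - i).sign * ((k : ℤ) - i).sign * ((l : ℤ) - i).sign) *
    ((((k : ℤ) - j).sign * ((l : ℤ) - j).sign) * ((l : ℤ) - k).sign)

-- The sign of a permutation is the sign of its Vandermonde product, and a repeated index makes the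
-- product vanish. The integer form turns the symmetries of the symbol into finite checks by
-- `decide`.
set_option maxRecDepth 10000 in
theorem levi_eq_leviInt (i j k l : Fin 4) : levi i j k l = (leviInt i j k l : ℝ) := by
  have h : ∀ i j k l : Fin 4, Matrix.det (Matrix.of ![Pi.single i 1, Pi.single j 1,
      Pi.single k 1, Pi.single l 1] : Matrix (Fin 4) (Fin 4) ℤ) = leviInt i j k l := by
    simp only [Matrix.det_succ_row_zero, Fin.sum_univ_succ]
    decide
  rw [← h, levi, Int.cast_det]
  congr 1
  ext a b
  fin_cases a <;> simp [Pi.single_apply]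

theorem levi_swap_left (i j k l : Fin 4) : levi j i k l = -levi i j k l := by
  have h : ∀ i j k l : Fin 4, leviInt j i k l = -leviInt i j k l := by decide
  rw [levi_eq_leviInt, levi_eq_leviInt, h]; simp

theorem levi_swap_right (i j k l : Fin 4) : levi i j l k = -levi i j k l := by
  have h : ∀ i j k l : Fin 4, leviInt i j l k = -leviInt i j k l := by decide
  rw [levi_eq_leviInt, levi_eq_leviInt, h]; simp

theorem levi_swap_mid (i j k l : Fin 4) : levi i k j l = -levi i j k l := by
  have h : ∀ i j k l : Fin 4, leviInt i k j l = -leviInt i j k l := by decide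
  rw [levi_eq_leviInt, levi_eq_leviInt, h]; simp

theorem levi_swap_pairs (i j k l : Fin 4) : levi k l i j = levi i j k l := by
  have h : ∀ i j k l : Fin 4, leviInt k l i j = leviInt i j k l := by decide
  rw [levi_eq_leviInt, levi_eq_leviInt, h]

theorem levi_rotate (i j k l : Fin 4) : levi j k i l = levi i j k l := by
  rw [levi_swap_mid, levi_swap_left, neg_neg]

/-- The dual of a bivector, with the flat Levi-Civita symbol. -/
def dual (P : Mat) : Mat := fun k l => (1 / 2 : ℝ) * ∑ i, ∑ j, levi i j k l * P i j

theorem dual_eq (P : Mat) : dual P = (1 / 2 : ℝ) •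
    !![0, P 2 3 - P 3 2, P 3 1 - P 1 3, P 1 2 - P 2 1;
       P 3 2 - P 2 3, 0, P 0 3 - P 3 0, P 2 0 - P 0 2;
       P 1 3 - P 3 1, P 3 0 - P 0 3, 0, P 0 1 - P 1 0;
       P 2 1 - P 1 2, P 0 2 - P 2 0, P 1 0 - P 0 1, 0] := by
  have h2 : Int.sign 2 = 1 := rfl
  have h3 : Int.sign 3 = 1 := rfl
  ext k l
  fin_cases k <;> fin_cases l <;>
    simp [dual, levi_eq_leviInt, Fin.sum_univ_succ, leviInt, h2, h3] <;> ring

/-- The skew-symmetric matrix with given entries above the diagonal. -/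
def skewMat (a b c d e f : ℝ) : Mat := !![0, a, b, c; -a, 0, d, e; -b, -d, 0, f; -c, -e, -f, 0]

theorem exists_skewMat {P : Mat} (h : ∀ i j, P i j = -P j i) :
    P = skewMat (P 0 1) (P 0 2) (P 0 3) (P 1 2) (P 1 3) (P 2 3) := by
  ext i j
  have h0 : ∀ i, P i i = 0 := fun i => by linarith [h i i]
  fin_cases i <;> fin_cases j <;> simp [skewMat, h0] <;> exact h _ _

/-- On the six independent entries duality is a signed permutation, so the quadratic identities
below become polynomial identities in these entries. -/
theorem dual_skewMat (a b c d e f : ℝ) :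
    dual (skewMat a b c d e f) = skewMat f (-e) d c (-b) a := by
  rw [dual_eq]
  ext i j
  fin_cases i <;> fin_cases j <;> simp [skewMat] <;> ring

theorem dual_skew (P : Mat) (i j : Fin 4) : dual P i j = -dual P j i := by
  simp only [dual, levi_swap_right _ _ j i, neg_mul, Finset.sum_neg_distrib, mul_neg]

theorem dual_add (P Q : Mat) : dual (P + Q) = dual P + dual Q := by
  ext k l; simp only [dual, Matrix.add_apply, mul_add, Finset.sum_add_distrib]

theorem dual_smul (c : ℝ) (P : Mat) : dual (c • P) = c • dual P := by
  ext k l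
  simp only [dual, Matrix.smul_apply, smul_eq_mul, Finset.mul_sum]
  exact Finset.sum_congr rfl fun i _ => Finset.sum_congr rfl fun j _ => by ring

theorem dual_neg (P : Mat) : dual (-P) = -dual P := by
  simpa using dual_smul (-1) P

theorem dual_dual {P : Mat} (h : ∀ i j, P i j = -P j i) : dual (dual P) = P := by
  rw [exists_skewMat h, dual_skewMat, dual_skewMat]; simp

/-- Polarisation of the Pfaffian identity, by which `P * dual P` is a scalar matrix. -/
theorem mul_dual_add {P Q : Mat} (hP : ∀ i j, P i j = -P j i) (hQ : ∀ i j, Q i j = -Q j i) :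
    P * dual Q + Q * dual P = (1 / 2 * (P * dual Q).trace) • (1 : Mat) := by
  rw [exists_skewMat hP, exists_skewMat hQ, dual_skewMat, dual_skewMat]
  ext i j
  fin_cases i <;> fin_cases j <;>
    simp [skewMat, Fin.sum_univ_succ, Matrix.trace] <;> ring

/-- In substance `mul_dual_add` with `dual Q` in place of `Q`, since the flat dual is an involution.
-/
theorem mul_add_dual_mul {P Q : Mat} (hP : ∀ i j, P i j = -P j i) (hQ : ∀ i j, Q i j = -Q j i) :
    P * Q + dual Q * dual P = (1 / 2 * (P * Q).trace) • (1 : Mat) := by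
  rw [exists_skewMat hP, exists_skewMat hQ, dual_skewMat, dual_skewMat]
  ext i j
  fin_cases i <;> fin_cases j <;>
    simp [skewMat, Fin.sum_univ_succ, Matrix.trace] <;> ring

theorem ext_skew {P Q : Mat} (hP : ∀ i j, P i j = -P j i) (hQ : ∀ i j, Q i j = -Q j i)
    (h01 : P 0 1 = Q 0 1) (h02 : P 0 2 = Q 0 2) (h03 : P 0 3 = Q 0 3) (h12 : P 1 2 = Q 1 2)
    (h13 : P 1 3 = Q 1 3) (h23 : P 2 3 = Q 2 3) : P = Q := by
  rw [exists_skewMat hP, exists_skewMat hQ, h01, h02, h03, h12, h13, h23]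

/-- The derivative of `dual_congruence` at the identity in the direction `N`. With `N` the
connection matrix, it makes `∇` commute with the Hodge dual. -/
theorem dual_derivation {P : Mat} (hP : ∀ i j, P i j = -P j i) (N : Mat) :
    N.trace • dual P - dual (N * P + P * N.transpose) = N.transpose * dual P + dual P * N := by
  refine ext_skew (fun i j => ?_) (fun i j => ?_) ?_ ?_ ?_ ?_ ?_ ?_
  · simp only [Matrix.sub_apply, Matrix.smul_apply, smul_eq_mul, dual_skew _ i j]
    ring
  · simp only [Matrix.add_apply, Matrix.mul_apply, Matrix.transpose_apply, dual_skew P i,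
      dual_skew P _ j, mul_neg, Finset.sum_neg_distrib, neg_add, mul_comm]
    exact add_comm _ _
  all_goals
    rw [exists_skewMat hP, dual_skewMat, dual_eq]
    simp [skewMat, Matrix.mul_apply, Fin.sum_univ_succ, Matrix.trace, Matrix.vecMul,
      dotProduct]
    ring

theorem det_four (M : Mat) : M.det =
    M 0 0 * (M 1 1 * (M 2 2 * M 3 3 - M 2 3 * M 3 2) - M 1 2 * (M 2 1 * M 3 3 - M 2 3 * M 3 1)
      + M 1 3 * (M 2 1 * M 3 2 - M 2 2 * M 3 1))
    - M 0 1 * (M 1 0 * (M 2 2 * M 3 3 - M 2 3 * M 3 2) - M 1 2 * (M 2 0 * M 3 3 - M 2 3 * M 3 0)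
      + M 1 3 * (M 2 0 * M 3 2 - M 2 2 * M 3 0))
    + M 0 2 * (M 1 0 * (M 2 1 * M 3 3 - M 2 3 * M 3 1) - M 1 1 * (M 2 0 * M 3 3 - M 2 3 * M 3 0)
      + M 1 3 * (M 2 0 * M 3 1 - M 2 1 * M 3 0))
    - M 0 3 * (M 1 0 * (M 2 1 * M 3 2 - M 2 2 * M 3 1) - M 1 1 * (M 2 0 * M 3 2 - M 2 2 * M 3 0)
      + M 1 2 * (M 2 0 * M 3 1 - M 2 1 * M 3 0)) := by
  simp [Matrix.det_succ_row_zero, Fin.sum_univ_succ, Fin.succAbove]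
  ring

theorem mul_transpose_skew {P : Mat} (hP : ∀ i j, P i j = -P j i) (M : Mat) (i j : Fin 4) :
    (M * P * M.transpose) i j = -(M * P * M.transpose) j i := by
  have h : P.transpose = -P := by ext i j; exact hP j i
  have : (M * P * M.transpose).transpose = -(M * P * M.transpose) := by
    rw [Matrix.transpose_mul, Matrix.transpose_mul, Matrix.transpose_transpose, h]
    simp [Matrix.mul_assoc]
  simpa using congrFun (congrFun this j) i

theorem congruence_skewMat (M : Mat) (a b c d e f : ℝ) (i j : Fin 4) :
    (M * skewMat a b c d e f * M.transpose) i j =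
      a * (M i 0 * M j 1 - M i 1 * M j 0) + b * (M i 0 * M j 2 - M i 2 * M j 0)
      + c * (M i 0 * M j 3 - M i 3 * M j 0) + d * (M i 1 * M j 2 - M i 2 * M j 1)
      + e * (M i 1 * M j 3 - M i 3 * M j 1) + f * (M i 2 * M j 3 - M i 3 * M j 2) := by
  simp [skewMat, Matrix.mul_apply, Fin.sum_univ_succ]
  ring

/-- The Levi-Civita symbol is a tensor density: transforming all four of its indices by `M`
multiplies it by `M.det`. -/
theorem dual_congruence {P : Mat} (hP : ∀ i j, P i j = -P j i) (M : Mat) :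
    M.transpose * dual (M * P * M.transpose) * M = M.det • dual P := by
  have hs : ∀ i j, (M.transpose * dual (M * P * M.transpose) * M) i j =
      -(M.transpose * dual (M * P * M.transpose) * M) j i := by
    simpa using mul_transpose_skew (dual_skew (M * P * M.transpose)) M.transpose
  have ht : ∀ i j, (M.det • dual P) i j = -(M.det • dual P) j i := fun i j => by
    simp [dual_skew P i j]
  have h := congruence_skewMat M.transpose
  rw [Matrix.transpose_transpose] at h
  refine ext_skew hs ht ?_ ?_ ?_ ?_ ?_ ?_ <;>
  · rw [exists_skewMat (mul_transpose_skew hP M), dual_skewMat, h, exists_skewMat hP]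
    simp only [congruence_skewMat, dual_skewMat, det_four, Matrix.transpose_apply,
      Matrix.smul_apply, smul_eq_mul]
    simp only [skewMat, Matrix.of_apply, Matrix.cons_val]
    ring

/-! ### Hodge duality of 2-forms at a point. -/

/-- The Hodge dual of a 2-form, in matrix form. -/
def hod (G F : Mat) : Mat := Real.sqrt |G.det| • dual (G⁻¹ * F * G⁻¹)

section Pointwise

variable {G : Mat}

theorem inv_symm_of_symm (hG : G.transpose = G) : (G⁻¹).transpose = G⁻¹ := by
  rw [Matrix.transpose_nonsing_inv, hG]

theorem inv_apply_symm (hG : G.transpose = G) (i j : Fin 4) : G⁻¹ i j = G⁻¹ j i :=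
  congrFun (congrFun (inv_symm_of_symm hG) j) i

theorem raise2_eq (hG : G.transpose = G) (F : Mat) (i j : Fin 4) :
    raise2 G F i j = (G⁻¹ * F * G⁻¹) i j := by
  simp only [raise2, Matrix.mul_apply, Finset.sum_mul, smul_eq_mul]
  rw [Finset.sum_comm]
  refine Finset.sum_congr rfl fun b _ => Finset.sum_congr rfl fun a _ => ?_
  rw [inv_apply_symm hG j b]; ring

theorem hodge2_eq_hod (hG : G.transpose = G) (F : Mat) (k l : Fin 4) :
    hodge2 G F k l = hod G F k l := by
  simp only [hodge2, raise2_eq hG, eta, hod, dual, Matrix.smul_apply, smul_eq_mul,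
    Finset.mul_sum]
  exact Finset.sum_congr rfl fun b _ => Finset.sum_congr rfl fun a _ => by ring

theorem sqrt_det_sq (hdet : G.det < 0) : Real.sqrt |G.det| * Real.sqrt |G.det| = -G.det := by
  rw [Real.mul_self_sqrt (abs_nonneg _), abs_of_neg hdet]

theorem hod_skew (F : Mat) (i j : Fin 4) : hod G F i j = -hod G F j i := by
  simp [hod, dual_skew _ i j]

theorem hod_add (F H : Mat) : hod G (F + H) = hod G F + hod G H := by
  simp [hod, mul_add, add_mul, dual_add]

theorem hod_smul (c : ℝ) (F : Mat) : hod G (c • F) = c • hod G F := by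
  simp only [hod, Matrix.mul_smul, Matrix.smul_mul, dual_smul]
  exact smul_comm _ _ _

theorem hod_neg (F : Mat) : hod G (-F) = -hod G F := by
  simpa using hod_smul (G := G) (-1) F

theorem raise_skew (hG : G.transpose = G) {F : Mat} (hF : ∀ i j, F i j = -F j i) (i j : Fin 4) :
    (G⁻¹ * F * G⁻¹) i j = -(G⁻¹ * F * G⁻¹) j i := by
  simpa [inv_symm_of_symm hG] using mul_transpose_skew hF G⁻¹ i j

theorem lower_raise (hdet : G.det < 0) (F : Mat) : G * (G⁻¹ * F * G⁻¹) * G = F := by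
  have hu : IsUnit G.det := hdet.ne.isUnit
  rw [Matrix.mul_assoc G⁻¹, Matrix.mul_nonsing_inv_cancel_left _ _ hu,
    Matrix.nonsing_inv_mul_cancel_right _ _ hu]

/-- This is `dual_congruence` with `M = G`, applied to `F` with both indices raised. -/
theorem dual_eq_congr (hG : G.transpose = G) (hdet : G.det < 0) {F : Mat}
    (hF : ∀ i j, F i j = -F j i) :
    dual F = G.det • (G⁻¹ * dual (G⁻¹ * F * G⁻¹) * G⁻¹) := by
  have hu : IsUnit G.det := hdet.ne.isUnit
  have h := dual_congruence (raise_skew hG hF) G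
  rw [hG, lower_raise hdet] at h
  rw [← Matrix.smul_mul, ← Matrix.mul_smul, ← h, Matrix.mul_assoc G,
    Matrix.nonsing_inv_mul_cancel_left _ _ hu, Matrix.mul_nonsing_inv_cancel_right _ _ hu]

/-- The flat dual is an involution; the sign comes from `√|det g|² = -det g`, that is, from
Lorentzian signature. -/
theorem hod_hod (hG : G.transpose = G) (hdet : G.det < 0) {F : Mat}
    (hF : ∀ i j, F i j = -F j i) : hod G (hod G F) = -F := by
  have h := dual_eq_congr hG hdet hF
  have h2 : hod G (hod G F) = (-1 : ℝ) • dual (dual F) := by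
    rw [h]
    simp only [hod, Matrix.mul_smul, Matrix.smul_mul, dual_smul, smul_smul, sqrt_det_sq hdet]
    ring_nf
  rw [h2, dual_dual hF]; simp

theorem mul_hod_add (hG : G.transpose = G) (hdet : G.det < 0) {F H : Mat}
    (hF : ∀ i j, F i j = -F j i) (hH : ∀ i j, H i j = -H j i) :
    F * G⁻¹ * hod G H + H * G⁻¹ * hod G F = (1 / 2 * (G⁻¹ * F * G⁻¹ * hod G H).trace) • G := by
  have hu : IsUnit G.det := hdet.ne.isUnit
  have h := congrArg (fun Y => Real.sqrt |G.det| • (G * Y))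
    (mul_dual_add (raise_skew hG hF) (raise_skew hG hH))
  simp only [mul_add, ← Matrix.mul_assoc, Matrix.mul_nonsing_inv _ hu, one_mul, Matrix.mul_smul,
    mul_one, smul_add] at h
  simp only [hod, Matrix.mul_smul, h, smul_smul, Matrix.trace_smul, smul_eq_mul]
  ring_nf

theorem mul_sub_hod_mul (hG : G.transpose = G) (hdet : G.det < 0) {F H : Mat}
    (hF : ∀ i j, F i j = -F j i) (hH : ∀ i j, H i j = -H j i) :
    F * G⁻¹ * H - hod G H * G⁻¹ * hod G F = (1 / 2 * (G⁻¹ * F * G⁻¹ * H).trace) • G := by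
  have hu : IsUnit G.det := hdet.ne.isUnit
  have h := congrArg (fun Y => Y * G) (mul_add_dual_mul hF (raise_skew hG hH))
  have hc : ∀ F : Mat, G⁻¹ * F * G⁻¹ * G = G⁻¹ * F := fun F =>
    Matrix.nonsing_inv_mul_cancel_right _ _ hu
  simp only [add_mul, dual_eq_congr hG hdet hF, Matrix.mul_smul, Matrix.smul_mul, one_mul,
    Matrix.mul_assoc _ _ G] at h
  simp only [Matrix.nonsing_inv_mul _ hu, mul_one] at h
  have ht : (G⁻¹ * F * G⁻¹ * H).trace = (F * (G⁻¹ * H * G⁻¹)).trace := by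
    rw [Matrix.mul_assoc, Matrix.mul_assoc, Matrix.trace_mul_comm]
    simp only [Matrix.mul_assoc]
  rw [ht, ← h]
  simp only [hod, Matrix.mul_smul, Matrix.smul_mul, smul_smul, sqrt_det_sq hdet, neg_smul,
    sub_neg_eq_add, Matrix.mul_assoc]

theorem trace_hod_comm (hG : G.transpose = G) {F H : Mat}
    (hF : ∀ i j, F i j = -F j i) (hH : ∀ i j, H i j = -H j i) :
    (G⁻¹ * F * G⁻¹ * hod G H).trace = (G⁻¹ * H * G⁻¹ * hod G F).trace := by
  have h := congrArg Matrix.trace (mul_dual_add (raise_skew hG hF) (raise_skew hG hH))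
  simp only [Matrix.trace_add, Matrix.trace_smul, Matrix.trace_one, Fintype.card_fin,
    smul_eq_mul] at h
  push_cast at h
  simp only [hod, Matrix.mul_smul, Matrix.trace_smul, smul_eq_mul]
  linear_combination (-Real.sqrt |G.det|) * h

end Pointwise

/-! ### Contractions with the metric and the volume element; the Killing-Yano condition at a point.
-/

section Pointwise

variable {G : Mat}

/-- The 2-form `v ∧ g(∂_k, ·)`. -/
def wedgeMetric (G : Mat) (v : Fin 4 → ℝ) (k : Fin 4) : Mat :=
  fun i j => v i * G k j - v j * G k i

theorem sum_raise1_mul_metric (hG : G.transpose = G) (hdet : G.det < 0) (v : Fin 4 → ℝ)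
    (i : Fin 4) : ∑ m, raise1 G v m * G m i = v i := by
  have h : (G * G⁻¹) = 1 := Matrix.mul_nonsing_inv _ hdet.ne.isUnit
  have h' := congrFun (congrArg (fun M : Mat => M.mulVec v) h) i
  simp only [Matrix.one_mulVec, ← Matrix.mulVec_mulVec] at h'
  rw [← h']
  simp only [Matrix.mulVec, dotProduct, raise1, smul_eq_mul]
  refine Finset.sum_congr rfl fun m _ => ?_
  rw [show G m i = G i m from congrFun (congrFun hG i) m]
  ring

theorem sum_raise1_mul_metric2 (hG : G.transpose = G) (hdet : G.det < 0) (v : Fin 4 → ℝ)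
    (k i j : Fin 4) : ∑ m, raise1 G v m * metric2 G m k i j = wedgeMetric G v k i j := by
  simp only [metric2, mul_sub, Finset.sum_sub_distrib, ← mul_assoc, ← Finset.sum_mul,
    sum_raise1_mul_metric hG hdet, wedgeMetric]

theorem raise_wedgeMetric (hG : G.transpose = G) (hdet : G.det < 0) (v : Fin 4 → ℝ)
    (k a b : Fin 4) : (G⁻¹ * wedgeMetric G v k * G⁻¹) a b =
      raise1 G v a * (if b = k then 1 else 0) - raise1 G v b * (if a = k then 1 else 0) := by
  have hu : IsUnit G.det := hdet.ne.isUnit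
  have hw : wedgeMetric G v k = Matrix.vecMulVec v (G k) - Matrix.vecMulVec (G k) v := by
    ext i j; simp [wedgeMetric, Matrix.vecMulVec_apply, mul_comm]
  have h1 : Matrix.vecMul (G k) G⁻¹ = (1 : Mat) k := by
    rw [← Matrix.mul_nonsing_inv _ hu]; rfl
  have h2 : Matrix.mulVec G⁻¹ (G k) = (1 : Mat) k := by
    rw [← h1, ← Matrix.mulVec_transpose, inv_symm_of_symm hG]
  have h3 : Matrix.mulVec G⁻¹ v = raise1 G v := by
    ext i; simp [Matrix.mulVec, dotProduct, raise1]
  have h4 : Matrix.vecMul v G⁻¹ = raise1 G v := by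
    rw [← h3, ← Matrix.mulVec_transpose, inv_symm_of_symm hG]
  rw [hw, mul_sub, sub_mul, Matrix.mul_vecMulVec, Matrix.vecMulVec_mul, Matrix.mul_vecMulVec,
    Matrix.vecMulVec_mul, h1, h2, h3, h4]
  simp [Matrix.vecMulVec_apply, Matrix.one_apply, eq_comm]

theorem sum_raise1_mul_eta (hG : G.transpose = G) (hdet : G.det < 0) (v : Fin 4 → ℝ)
    (k i j : Fin 4) :
    ∑ m, raise1 G v m * eta G m k i j = hod G (wedgeMetric G v k) i j := by
  simp only [hod, dual, Matrix.smul_apply, smul_eq_mul, raise_wedgeMetric hG hdet, mul_sub,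
    Finset.sum_sub_distrib]
  have h1 : ∑ a, ∑ b, levi a b i j * (raise1 G v a * (if b = k then (1 : ℝ) else 0)) =
      ∑ m, raise1 G v m * levi m k i j := by simp [mul_comm]
  have h2 : ∑ a, ∑ b, levi a b i j * (raise1 G v b * (if a = k then (1 : ℝ) else 0)) =
      -∑ m, raise1 G v m * levi m k i j := by
    rw [Finset.sum_comm]
    simp only [levi_swap_left k, mul_ite, mul_one, mul_zero, Finset.sum_ite_eq',
      Finset.mem_univ, if_true, ← Finset.sum_neg_distrib]
    refine Finset.sum_congr rfl fun m _ => ?_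
    rw [levi_swap_left m k]; ring
  rw [h1, h2]
  simp only [eta, Finset.mul_sum, ← Finset.sum_neg_distrib, ← Finset.sum_sub_distrib]
  exact Finset.sum_congr rfl fun m _ => by ring

/-- The array is the contraction of `v` with `η`, hence totally skew. -/
theorem hod_wedgeMetric_skew (hG : G.transpose = G) (hdet : G.det < 0) (v : Fin 4 → ℝ)
    (k i j : Fin 4) : hod G (wedgeMetric G v k) i j = -hod G (wedgeMetric G v i) k j := by
  simp only [← sum_raise1_mul_eta hG hdet, eta, levi_swap_mid _ i k, ← Finset.sum_neg_distrib]
  exact Finset.sum_congr rfl fun m _ => by ring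

/-- The codivergence `-∇^a T_{al}` of an array `T_{kij} = ∇_k T_{ij}`. -/
def codiv {R : Type*} [CommRing R] [Algebra ℝ R] (G : Mat) (T : Fin 4 → Fin 4 → Fin 4 → R)
    (l : Fin 4) : R :=
  -∑ m, ∑ k, G⁻¹ m k • T k m l

theorem inter4_selfDualMetric (hG : G.transpose = G) (hdet : G.det < 0) (a b : Fin 4 → ℝ)
    (k i j : Fin 4) :
    inter4 G (fun l => (a l : ℂ) + Complex.I * b l) (selfDualMetric G) k i j =
      (1 / 2 : ℂ) * ((wedgeMetric G a k i j + hod G (wedgeMetric G b k) i j : ℝ)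
        + Complex.I * (wedgeMetric G b k i j - hod G (wedgeMetric G a k) i j : ℝ)) := by
  have h : ∀ m, raise1 G (fun l => (a l : ℂ) + Complex.I * b l) m =
      ((raise1 G a m : ℝ) : ℂ) + Complex.I * ((raise1 G b m : ℝ) : ℂ) := by
    intro m
    simp only [raise1, smul_add, Finset.sum_add_distrib, Complex.real_smul, smul_eq_mul,
      Complex.ofReal_sum, Complex.ofReal_mul, Finset.mul_sum]
    congr 1
    exact Finset.sum_congr rfl fun m _ => by ring
  simp only [inter4, h, selfDualMetric, ← sum_raise1_mul_metric2 hG hdet,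
    ← sum_raise1_mul_eta hG hdet, Complex.ofReal_add, Complex.ofReal_sub, Complex.ofReal_sum,
    Complex.ofReal_mul, Finset.mul_sum, ← Finset.sum_add_distrib, ← Finset.sum_sub_distrib]
  refine Finset.sum_congr rfl fun m _ => ?_
  linear_combination (-(1 / 2 : ℂ) * (raise1 G b m : ℝ) * eta G m k i j) * Complex.I_mul_I

/-- Schouten's identity `δ^m_{[k} ε_{abij]} = 0`, contracted with a trivector. -/
theorem dual_trivector {Z : Fin 4 → Mat} (h1 : ∀ m a b, Z m a b = -Z m b a)
    (h2 : ∀ m a b, Z m a b = -Z a m b) (m i j : Fin 4) :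
    dual (Z m) i j = (1 / 3) * ((if m = i then 1 else 0) * ∑ n, dual (Z n) n j
      - (if m = j then 1 else 0) * ∑ n, dual (Z n) n i) := by
  have hz : ∀ a b, Z a a b = 0 := fun a b => by linarith [h2 a a b]
  have hy : ∀ a b, Z a b a = 0 := fun a b => by rw [h1, hz, neg_zero]
  have h0 : Z 0 = skewMat 0 0 0 (Z 0 1 2) (Z 0 1 3) (Z 0 2 3) := by
    rw [exists_skewMat (h1 0)]; simp [skewMat, hz]
  have h1' : Z 1 = skewMat 0 (-Z 0 1 2) (-Z 0 1 3) 0 0 (Z 1 2 3) := by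
    rw [exists_skewMat (h1 1)]
    simp only [hy, hz, h2 1 0]
    simp [skewMat]
  have h2' : Z 2 = skewMat (Z 0 1 2) 0 (-Z 0 2 3) 0 (-Z 1 2 3) 0 := by
    rw [exists_skewMat (h1 2)]
    simp only [hy, hz, h2 2 0, h2 2 1, h1 0 2 1]
    simp [skewMat]
  have h3' : Z 3 = skewMat (Z 0 1 3) (Z 0 2 3) 0 (Z 1 2 3) 0 0 := by
    rw [exists_skewMat (h1 3)]
    simp only [hy, h2 3 0, h2 3 1, h1 0 3, h1 1 3 2]
    simp [skewMat]
  simp only [Fin.sum_univ_four]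
  generalize Z 0 1 2 = p at *
  generalize Z 0 1 3 = q at *
  generalize Z 0 2 3 = r at *
  generalize Z 1 2 3 = s at *
  have d0 := congrArg dual h0
  have d1 := congrArg dual h1'
  have d2 := congrArg dual h2'
  have d3 := congrArg dual h3'
  rw [dual_skewMat] at d0 d1 d2 d3
  fin_cases m <;> simp only [Fin.zero_eta, Fin.mk_one, Fin.reduceFinMk, d0, d1, d2, d3] <;>
    fin_cases i <;> fin_cases j <;> simp [skewMat] <;> ring

theorem hod_eq_wedgeMetric (hG : G.transpose = G) (hdet : G.det < 0) {T : Fin 4 → Mat}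
    (hT : ∀ k i j, T k i j = -T k j i) (hT' : ∀ k i j, T k i j = -T i k j) (k : Fin 4) :
    hod G (T k) = (1 / 3 : ℝ) • wedgeMetric G (codiv G fun k => hod G (T k)) k := by
  have hu : IsUnit G.det := hdet.ne.isUnit
  -- `Z` is `T` with all three indices raised, a trivector to which `dual_trivector` applies.
  set Z : Fin 4 → Mat := fun m => ∑ k, G⁻¹ m k • (G⁻¹ * T k * G⁻¹) with hZ
  have hZs : ∀ m i j, Z m i j = ∑ k, ∑ a, ∑ b, G⁻¹ m k * G⁻¹ i a * G⁻¹ j b * T k a b := by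
    intro m i j
    simp only [hZ, Matrix.sum_apply, Matrix.smul_apply, ← raise2_eq hG]
    simp only [raise2, smul_eq_mul, Finset.mul_sum, mul_assoc]
  have hZ1 : ∀ m i j, Z m i j = -Z m j i := by
    intro m i j
    rw [hZs, hZs, ← Finset.sum_neg_distrib]
    refine Finset.sum_congr rfl fun k _ => ?_
    rw [Finset.sum_comm, ← Finset.sum_neg_distrib]
    refine Finset.sum_congr rfl fun a _ => ?_
    rw [← Finset.sum_neg_distrib]
    refine Finset.sum_congr rfl fun b _ => ?_
    rw [hT k b a]; ring
  have hZ2 : ∀ m i j, Z m i j = -Z i m j := by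
    intro m i j
    rw [hZs, hZs, Finset.sum_comm, ← Finset.sum_neg_distrib]
    refine Finset.sum_congr rfl fun k _ => ?_
    rw [← Finset.sum_neg_distrib]
    refine Finset.sum_congr rfl fun a _ => ?_
    rw [← Finset.sum_neg_distrib]
    refine Finset.sum_congr rfl fun b _ => ?_
    rw [hT' a k b]; ring
  have hd : ∀ m, Real.sqrt |G.det| • dual (Z m) = ∑ k, G⁻¹ m k • hod G (T k) := by
    intro m
    have hlin : ∀ (c : Fin 4 → ℝ) (P : Fin 4 → Mat),
        dual (∑ k, c k • P k) = ∑ k, c k • dual (P k) := by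
      intro c P
      simp only [Fin.sum_univ_four, dual_add, dual_smul]
    simp only [hZ, hlin, hod, Finset.smul_sum]
    exact Finset.sum_congr rfl fun k _ => smul_comm _ _ _
  have hv : ∀ j, Real.sqrt |G.det| * ∑ n, dual (Z n) n j =
      -codiv G (fun k => hod G (T k)) j := by
    intro j
    simp only [codiv, neg_neg, Finset.mul_sum]
    refine Finset.sum_congr rfl fun n _ => ?_
    simpa [Matrix.sum_apply] using congrFun (congrFun (hd n) n) j
  have hk : hod G (T k) = ∑ m, G k m • (Real.sqrt |G.det| • dual (Z m)) := by
    simp only [hd, Finset.smul_sum, smul_smul]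
    rw [Finset.sum_comm]
    have h1 : ∀ n, ∑ m, G k m * G⁻¹ m n = (1 : Mat) k n := fun n => by
      rw [← Matrix.mul_nonsing_inv _ hu, Matrix.mul_apply]
    simp [← Finset.sum_smul, h1, Matrix.one_apply]
  rw [hk]
  ext i j
  simp only [Matrix.sum_apply, Matrix.smul_apply, smul_eq_mul, wedgeMetric]
  have hterm : ∀ m, G k m * (Real.sqrt |G.det| * dual (Z m) i j) =
      (1 / 3) * ((if m = j then 1 else 0) * G k m * codiv G (fun k => hod G (T k)) i
        - (if m = i then 1 else 0) * G k m * codiv G (fun k => hod G (T k)) j) := by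
    intro m
    rw [dual_trivector hZ1 hZ2 m i j]
    linear_combination (1 / 3 * G k m * (if m = i then 1 else 0)) * hv j
      - (1 / 3 * G k m * (if m = j then 1 else 0)) * hv i
  simp only [hterm, ← Finset.mul_sum, Finset.sum_sub_distrib, ← Finset.sum_mul]
  simp
  ring

/-- The conformal Killing-Yano form of the Killing-Yano equation. -/
theorem killingYano_iff (hG : G.transpose = G) (hdet : G.det < 0) {T : Fin 4 → Mat}
    (hT : ∀ k i j, T k i j = -T k j i) :
    (∀ k i j, T k i j = -T i k j) ↔ (∀ l, codiv G (fun k => T k) l = 0) ∧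
      ∀ k i j, (T k i j : ℂ) - Complex.I * (hod G (T k) i j : ℝ) = (2 / 3 : ℂ) *
        inter4 G (fun l => ((codiv G (fun k => T k) l : ℝ) : ℂ) - Complex.I *
          ((codiv G (fun k => hod G (T k)) l : ℝ) : ℂ)) (selfDualMetric G) k i j := by
  set a := codiv G (fun k => T k) with ha
  set b := codiv G (fun k => hod G (T k)) with hb
  have hI := inter4_selfDualMetric hG hdet a (fun l => -b l)
  simp only [Complex.ofReal_neg, mul_neg, ← sub_eq_add_neg] at hI
  simp only [hI]
  have hw : ∀ k, wedgeMetric G (fun l => -b l) k = -wedgeMetric G b k := by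
    intro k; ext i j; simp [wedgeMetric]; ring
  simp only [hw, hod_neg, Matrix.neg_apply]
  constructor
  · intro h
    have hS := hod_eq_wedgeMetric hG hdet hT h
    -- The symmetric inverse metric is contracted with a pair of indices in which `T` is skew.
    have ha0 : ∀ l, a l = 0 := by
      intro l
      have hc : a l = -∑ m, ∑ k, G⁻¹ m k * T k m l := rfl
      have hs : ∑ m, ∑ k, G⁻¹ m k * T k m l = -∑ m, ∑ k, G⁻¹ m k * T k m l := by
        conv_lhs => rw [Finset.sum_comm]
        rw [← Finset.sum_neg_distrib]
        refine Finset.sum_congr rfl fun m _ => ?_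
        rw [← Finset.sum_neg_distrib]
        refine Finset.sum_congr rfl fun k _ => ?_
        rw [h m k l, inv_apply_symm hG k m]; ring
      linarith
    refine ⟨ha0, fun k i j => ?_⟩
    have ha' : wedgeMetric G a k = 0 := by ext i j; simp [wedgeMetric, ha0]
    have hTk : T k = -((1 / 3 : ℝ) • hod G (wedgeMetric G b k)) := by
      rw [← hod_smul, ← hS, hod_hod hG hdet (hT k), neg_neg]
    have h0 : hod G 0 = 0 := by simpa using hod_smul (G := G) 0 0
    rw [hS k, hTk, ha', h0]
    simp only [Matrix.neg_apply, Matrix.smul_apply, smul_eq_mul, Matrix.zero_apply]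
    push_cast
    ring
  · rintro ⟨ha0, h⟩ k i j
    -- Once `a = 0`, the real part exhibits `T` as a contraction of `η`, which is totally skew.
    have hre : ∀ k i j, T k i j = -(1 / 3) * hod G (wedgeMetric G b k) i j := by
      intro k i j
      have ha' : wedgeMetric G a k = 0 := by ext i j; simp [wedgeMetric, ha0]
      have := congrArg Complex.re (h k i j)
      rw [ha'] at this
      simp at this
      linarith
    rw [hre, hre, hod_wedgeMetric_skew hG hdet]; ring

end Pointwise

/-! ### Elimination of the differential of the complex scalar. -/

/-- The elimination at the heart of the theorem, for abstract contractions `I2` with `𝒰` and `I4`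
with `𝒢`. -/
theorem conformalKilling_iff {lam d : Fin 4 → ℂ} {u p : Fin 4 → Fin 4 → ℂ}
    {D : Fin 4 → Fin 4 → Fin 4 → ℂ} (I2 : (Fin 4 → ℂ) →ₗ[ℂ] (Fin 4 → ℂ))
    (I4 : (Fin 4 → ℂ) →ₗ[ℂ] (Fin 4 → Fin 4 → Fin 4 → ℂ))
    (hu : ∑ i, ∑ j, p i j * u i j = -2) (hD : ∀ k, ∑ i, ∑ j, p i j * D k i j = 0)
    (hI4 : ∀ v k, ∑ i, ∑ j, p i j * I4 v k i j = 2 * I2 v k)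
    (hI2 : ∀ v, I2 (I2 v) = (1 / 2 : ℂ) • v) :
    (∀ k i j, lam k * u i j + D k i j = (2 / 3) * I4 (d - I2 lam) k i j) ↔
      (∀ k i j, D k i j - I2 d k * u i j - I4 d k i j = 0) ∧ lam = -I2 d := by
  -- The factor `1 + 1/2`, from `I2 ∘ I2 = 1/2`, cancels the coefficient `2/3`.
  have key : lam = -I2 d → d - I2 lam = (3 / 2 : ℂ) • d := by
    intro h
    rw [h, map_neg, hI2]
    ext l; simp; ring
  constructor
  · intro h
    have hl : lam = -I2 d := by
      ext k
      have h1 : ∑ i, ∑ j, p i j * (lam k * u i j + D k i j) =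
          ∑ i, ∑ j, p i j * ((2 / 3) * I4 (d - I2 lam) k i j) := by simp only [h]
      have h2 : ∑ i, ∑ j, p i j * (lam k * u i j + D k i j) =
          lam k * ∑ i, ∑ j, p i j * u i j + ∑ i, ∑ j, p i j * D k i j := by
        simp only [Finset.mul_sum, ← Finset.sum_add_distrib]
        exact Finset.sum_congr rfl fun i _ => Finset.sum_congr rfl fun j _ => by ring
      have h3 : ∑ i, ∑ j, p i j * ((2 / 3) * I4 (d - I2 lam) k i j) =
          (2 / 3) * ∑ i, ∑ j, p i j * I4 (d - I2 lam) k i j := by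
        simp only [Finset.mul_sum]
        exact Finset.sum_congr rfl fun i _ => Finset.sum_congr rfl fun j _ => by ring
      rw [h2, h3, hu, hD, hI4, map_sub, hI2] at h1
      simp only [Pi.sub_apply, Pi.smul_apply, smul_eq_mul] at h1
      simp only [Pi.neg_apply]
      -- The contracted equation reads `-2 λ = (4/3) (I2 d - λ/2)`.
      linear_combination (-3 / 4) * h1
    refine ⟨fun k i j => ?_, hl⟩
    have h1 := h k i j
    rw [key hl, map_smul, hl] at h1
    simp only [Pi.smul_apply, smul_eq_mul, Pi.neg_apply] at h1
    linear_combination h1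
  · rintro ⟨h, hl⟩ k i j
    rw [key hl, map_smul, hl]
    simp only [Pi.smul_apply, smul_eq_mul, Pi.neg_apply]
    linear_combination h k i j

/-! ### Algebra of self-dual 2-forms and the theorem at a point. -/

section Pointwise

variable {G : Mat}

theorem raise1_add (G : Mat) (v w : Fin 4 → ℂ) : raise1 G (v + w) = raise1 G v + raise1 G w := by
  ext i; simp [raise1, Finset.sum_add_distrib]

theorem raise1_smul (G : Mat) (c : ℂ) (v : Fin 4 → ℂ) : raise1 G (c • v) = c • raise1 G v := by
  ext i
  simp only [raise1, Pi.smul_apply, smul_eq_mul, Finset.mul_sum, Complex.real_smul]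
  exact Finset.sum_congr rfl fun j _ => by ring

/-- `inter2` as a linear map in the vector. -/
def inter2Lin (G : Mat) (u : Fin 4 → Fin 4 → ℂ) : (Fin 4 → ℂ) →ₗ[ℂ] (Fin 4 → ℂ) where
  toFun v := inter2 G v u
  map_add' v w := by ext k; simp [inter2, raise1_add, add_mul, Finset.sum_add_distrib]
  map_smul' c v := by ext k; simp [inter2, raise1_smul, Finset.mul_sum, mul_assoc]

/-- `inter4` as a linear map in the vector. -/
def inter4Lin (G : Mat) (Q : Fin 4 → Fin 4 → Fin 4 → Fin 4 → ℂ) :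
    (Fin 4 → ℂ) →ₗ[ℂ] (Fin 4 → Fin 4 → Fin 4 → ℂ) where
  toFun v := inter4 G v Q
  map_add' v w := by ext k; simp [inter4, raise1_add, add_mul, Finset.sum_add_distrib]
  map_smul' c v := by ext k; simp [inter4, raise1_smul, Finset.mul_sum, mul_assoc]

theorem sum_mul_eq_trace {P : Mat} (hP : ∀ i j, P i j = -P j i) (H : Mat) :
    ∑ i, ∑ j, P i j * H i j = -(P * H).trace := by
  simp only [Matrix.trace, Matrix.diag_apply, Matrix.mul_apply, ← Finset.sum_neg_distrib]
  rw [Finset.sum_comm]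
  exact Finset.sum_congr rfl fun i _ => Finset.sum_congr rfl fun j _ => by rw [hP j i]; ring

theorem sum_metric2_mul_raise (hG : G.transpose = G) (hdet : G.det < 0) {F : Mat}
    (hF : ∀ i j, F i j = -F j i) (m k : Fin 4) :
    ∑ i, ∑ j, (G⁻¹ * F * G⁻¹) i j * metric2 G m k i j = 2 * F m k := by
  have h : ∀ m k, ∑ i, ∑ j, G m i * (G⁻¹ * F * G⁻¹) i j * G k j = F m k := by
    intro m k
    conv_rhs => rw [← lower_raise hdet F, Matrix.mul_apply]
    rw [Finset.sum_comm]
    refine Finset.sum_congr rfl fun j _ => ?_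
    rw [Matrix.mul_apply, Finset.sum_mul]
    refine Finset.sum_congr rfl fun i _ => ?_
    rw [show G k j = G j k from congrFun (congrFun hG j) k]
  have e : ∀ i j, (G⁻¹ * F * G⁻¹) i j * metric2 G m k i j =
      G m i * (G⁻¹ * F * G⁻¹) i j * G k j - G k i * (G⁻¹ * F * G⁻¹) i j * G m j := by
    intro i j
    rw [metric2]; ring
  simp only [e, Finset.sum_sub_distrib, h]
  rw [hF k m]; ring

theorem sum_eta_mul_raise (F : Mat) (m k : Fin 4) :
    ∑ i, ∑ j, (G⁻¹ * F * G⁻¹) i j * eta G m k i j = 2 * hod G F m k := by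
  simp only [hod, dual, Matrix.smul_apply, smul_eq_mul, eta, Finset.mul_sum]
  refine Finset.sum_congr rfl fun i _ => Finset.sum_congr rfl fun j _ => ?_
  rw [levi_swap_pairs i j m k]
  ring

theorem inter2_eq_vecMul (G : Mat) (v : Fin 4 → ℂ) (u : Matrix (Fin 4) (Fin 4) ℂ) :
    inter2 G v u = Matrix.vecMul (Matrix.mulVec (Complex.ofRealHom.mapMatrix G⁻¹) v) u := by
  ext k
  simp [inter2, raise1, Matrix.vecMul, Matrix.mulVec, dotProduct]

theorem inter2_inter2 (hG : G.transpose = G) (hdet : G.det < 0)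
    {u : Matrix (Fin 4) (Fin 4) ℂ} {c : ℂ}
    (hu : u * Complex.ofRealHom.mapMatrix G⁻¹ * u = c • Complex.ofRealHom.mapMatrix G)
    (v : Fin 4 → ℂ) : inter2 G (inter2 G v u) u = c • v := by
  have hs : ∀ w, Matrix.mulVec (Complex.ofRealHom.mapMatrix G⁻¹) w =
      Matrix.vecMul w (Complex.ofRealHom.mapMatrix G⁻¹) := by
    intro w
    rw [← Matrix.mulVec_transpose]
    congr 1
    ext i j
    simp [inv_apply_symm hG i j]
  rw [inter2_eq_vecMul, inter2_eq_vecMul, hs, Matrix.vecMul_vecMul, Matrix.vecMul_vecMul,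
    ← Matrix.mul_assoc, hu, hs, Matrix.vecMul_vecMul, Matrix.mul_smul, ← map_mul,
    Matrix.nonsing_inv_mul _ hdet.ne.isUnit, map_one, Matrix.vecMul_smul, Matrix.vecMul_one]

/-- A unitary 2-form at a point together with an array `D_{kij}` of 2-forms, the values of
`∇_k U_{ij}`. -/
structure UnitaryJet (G U : Mat) (D : Fin 4 → Mat) : Prop where
  skew : ∀ i j, U i j = -U j i
  deriv_skew : ∀ k i j, D k i j = -D k j i
  norm : (G⁻¹ * U * G⁻¹ * U).trace = 2
  norm_hod : (G⁻¹ * U * G⁻¹ * hod G U).trace = 0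
  deriv_norm : ∀ k, (G⁻¹ * U * G⁻¹ * D k).trace = 0
  deriv_norm_hod : ∀ k, (G⁻¹ * U * G⁻¹ * hod G (D k)).trace = 0

/-- The self-dual part `c (F - i *F)` of a 2-form. -/
def sdPart (c : ℂ) (G F : Mat) : Matrix (Fin 4) (Fin 4) ℂ :=
  fun i j => c * ((F i j : ℂ) - Complex.I * ((hod G F i j : ℝ) : ℂ))

theorem sdPart_eq (c : ℂ) (F : Mat) : sdPart c G F =
    c • (Complex.ofRealHom.mapMatrix F - Complex.I • Complex.ofRealHom.mapMatrix (hod G F)) := by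
  ext i j; simp [sdPart]

/-- The trace of `mul_sub_hod_mul`: the Hodge dual is an anti-isometry. -/
theorem trace_hod_hod (hG : G.transpose = G) (hdet : G.det < 0) {F H : Mat}
    (hF : ∀ i j, F i j = -F j i) (hH : ∀ i j, H i j = -H j i) :
    (G⁻¹ * hod G F * G⁻¹ * hod G H).trace = -(G⁻¹ * F * G⁻¹ * H).trace := by
  have h := congrArg (fun M => (G⁻¹ * M).trace) (mul_sub_hod_mul hG hdet hF hH)
  simp only [mul_sub, Matrix.trace_sub, Matrix.mul_smul, Matrix.trace_smul,
    Matrix.nonsing_inv_mul _ hdet.ne.isUnit, Matrix.trace_one, Fintype.card_fin, smul_eq_mul] at h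
  have hc : (G⁻¹ * hod G F * G⁻¹ * hod G H).trace =
      (G⁻¹ * (hod G H * G⁻¹ * hod G F)).trace := by
    rw [Matrix.mul_assoc (G⁻¹ * hod G F), Matrix.trace_mul_comm]
    simp only [Matrix.mul_assoc]
  rw [hc]
  simp only [← Matrix.mul_assoc] at h ⊢
  push_cast at h
  linear_combination -h

theorem trace_hod_left (hG : G.transpose = G) {F H : Mat}
    (hF : ∀ i j, F i j = -F j i) (hH : ∀ i j, H i j = -H j i) :
    (G⁻¹ * hod G F * G⁻¹ * H).trace = (G⁻¹ * F * G⁻¹ * hod G H).trace := by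
  rw [trace_hod_comm hG hF hH, Matrix.mul_assoc (G⁻¹ * hod G F), Matrix.trace_mul_comm]
  simp only [Matrix.mul_assoc]

theorem sum_sdPart_mul_sdPart (hG : G.transpose = G) (hdet : G.det < 0) {F H : Mat}
    (hF : ∀ i j, F i j = -F j i) (hH : ∀ i j, H i j = -H j i) {c : ℂ} (hc : c * c = 1 / 2) :
    ∑ i, ∑ j, (Complex.ofRealHom.mapMatrix G⁻¹ * sdPart c G F * Complex.ofRealHom.mapMatrix G⁻¹) i j
      * sdPart c G H i j = -((G⁻¹ * F * G⁻¹ * H).trace : ℂ)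
        + Complex.I * ((G⁻¹ * F * G⁻¹ * hod G H).trace : ℝ) := by
  have e : Complex.ofRealHom.mapMatrix G⁻¹ * sdPart c G F * Complex.ofRealHom.mapMatrix G⁻¹ =
      c • (Complex.ofRealHom.mapMatrix (G⁻¹ * F * G⁻¹)
        - Complex.I • Complex.ofRealHom.mapMatrix (G⁻¹ * hod G F * G⁻¹)) := by
    simp only [sdPart_eq, Matrix.mul_smul, Matrix.smul_mul, mul_sub, sub_mul, map_mul]
  have e2 : ∀ i j, (c • (Complex.ofRealHom.mapMatrix (G⁻¹ * F * G⁻¹)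
        - Complex.I • Complex.ofRealHom.mapMatrix (G⁻¹ * hod G F * G⁻¹))) i j
      * sdPart c G H i j = (1 / 2) * ((((G⁻¹ * F * G⁻¹) i j * H i j : ℝ) : ℂ)
        - ((G⁻¹ * hod G F * G⁻¹) i j * hod G H i j : ℝ)
        - Complex.I * (((G⁻¹ * F * G⁻¹) i j * hod G H i j : ℝ)
          + ((G⁻¹ * hod G F * G⁻¹) i j * H i j : ℝ))) := by
    intro i j
    simp only [sdPart, Matrix.smul_apply, Matrix.sub_apply, RingHom.mapMatrix_apply,
      Matrix.map_apply, Complex.ofRealHom_eq_coe, smul_eq_mul, Complex.ofReal_mul]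
    generalize (((G⁻¹ * F * G⁻¹) i j : ℝ) : ℂ) = p
    generalize (((G⁻¹ * hod G F * G⁻¹) i j : ℝ) : ℂ) = q
    generalize ((H i j : ℝ) : ℂ) = r
    generalize ((hod G H i j : ℝ) : ℂ) = s
    linear_combination ((p - Complex.I * q) * (r - Complex.I * s)) * hc
      + (1 / 2 * q * s) * Complex.I_mul_I
  simp only [e, e2, ← Finset.mul_sum, Finset.sum_sub_distrib, Finset.sum_add_distrib,
    ← Complex.ofReal_sum]
  rw [sum_mul_eq_trace (raise_skew hG hF), sum_mul_eq_trace (raise_skew hG hF),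
    sum_mul_eq_trace (raise_skew hG (hod_skew F)), sum_mul_eq_trace (raise_skew hG (hod_skew F)),
    trace_hod_hod hG hdet hF hH, trace_hod_left hG hF hH]
  push_cast
  ring

/-- The metric part and the volume part of `𝒢` contribute equally, because `-i *` acts as the
identity on `F - i *F`. -/
theorem sum_sdPart_mul_selfDualMetric (hG : G.transpose = G) (hdet : G.det < 0) {F : Mat}
    (hF : ∀ i j, F i j = -F j i) (c : ℂ) (m k : Fin 4) :
    ∑ i, ∑ j, (Complex.ofRealHom.mapMatrix G⁻¹ * sdPart c G F * Complex.ofRealHom.mapMatrix G⁻¹) i j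
      * selfDualMetric G m k i j = 2 * sdPart c G F m k := by
  have e : Complex.ofRealHom.mapMatrix G⁻¹ * sdPart c G F * Complex.ofRealHom.mapMatrix G⁻¹ =
      c • (Complex.ofRealHom.mapMatrix (G⁻¹ * F * G⁻¹)
        - Complex.I • Complex.ofRealHom.mapMatrix (G⁻¹ * hod G F * G⁻¹)) := by
    simp only [sdPart_eq, Matrix.mul_smul, Matrix.smul_mul, mul_sub, sub_mul, map_mul]
  have e2 : ∀ i j, (c • (Complex.ofRealHom.mapMatrix (G⁻¹ * F * G⁻¹)
        - Complex.I • Complex.ofRealHom.mapMatrix (G⁻¹ * hod G F * G⁻¹))) i j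
      * selfDualMetric G m k i j = (c / 2) * ((((G⁻¹ * F * G⁻¹) i j * metric2 G m k i j : ℝ) : ℂ)
        - ((G⁻¹ * hod G F * G⁻¹) i j * eta G m k i j : ℝ)
        - Complex.I * (((G⁻¹ * F * G⁻¹) i j * eta G m k i j : ℝ)
          + ((G⁻¹ * hod G F * G⁻¹) i j * metric2 G m k i j : ℝ))) := by
    intro i j
    simp only [selfDualMetric, Matrix.smul_apply, Matrix.sub_apply, RingHom.mapMatrix_apply,
      Matrix.map_apply, Complex.ofRealHom_eq_coe, smul_eq_mul, Complex.ofReal_mul]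
    generalize (((G⁻¹ * F * G⁻¹) i j : ℝ) : ℂ) = p
    generalize (((G⁻¹ * hod G F * G⁻¹) i j : ℝ) : ℂ) = q
    generalize ((eta G m k i j : ℝ) : ℂ) = s
    linear_combination (c / 2 * q * s) * Complex.I_mul_I
  simp only [e, e2, ← Finset.mul_sum, Finset.sum_sub_distrib, Finset.sum_add_distrib,
    ← Complex.ofReal_sum]
  rw [sum_metric2_mul_raise hG hdet hF, sum_metric2_mul_raise hG hdet (hod_skew F),
    sum_eta_mul_raise, sum_eta_mul_raise, hod_hod hG hdet hF, sdPart]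
  simp only [Matrix.neg_apply]
  push_cast
  ring

/-- The squares of `U` and `*U` differ by `G`, and the mixed products vanish by `norm_hod`. Hence
contracting twice with `𝒰` is multiplication by `1/2`. -/
theorem sdPart_mul_sdPart (hG : G.transpose = G) (hdet : G.det < 0) {U : Mat}
    (hU : ∀ i j, U i j = -U j i) (h1 : (G⁻¹ * U * G⁻¹ * U).trace = 2)
    (h2 : (G⁻¹ * U * G⁻¹ * hod G U).trace = 0) {c : ℂ} (hc : c * c = 1 / 2) :
    sdPart c G U * Complex.ofRealHom.mapMatrix G⁻¹ * sdPart c G U =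
      (1 / 2 : ℂ) • Complex.ofRealHom.mapMatrix G := by
  have e1 : U * G⁻¹ * U - hod G U * G⁻¹ * hod G U = G := by
    rw [mul_sub_hod_mul hG hdet hU hU, h1]; norm_num
  have e2 : U * G⁻¹ * hod G U = 0 := by
    have h := mul_hod_add hG hdet hU hU
    rw [h2, ← two_smul ℝ] at h
    simpa using h
  have e3 : hod G U * G⁻¹ * U = 0 := by
    have ht : ∀ {F : Mat}, (∀ i j, F i j = -F j i) → F.transpose = -F := fun h => by
      ext i j; exact h j i
    have h := congrArg Matrix.transpose e2
    simpa [Matrix.transpose_mul, ht hU, ht (hod_skew U), inv_symm_of_symm hG,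
      Matrix.mul_assoc] using h
  have e1' := congrArg Complex.ofRealHom.mapMatrix e1
  have e2' := congrArg Complex.ofRealHom.mapMatrix e2
  have e3' := congrArg Complex.ofRealHom.mapMatrix e3
  simp only [map_sub, map_mul, map_zero] at e1' e2' e3'
  simp only [sdPart_eq, Matrix.smul_mul, Matrix.mul_smul, sub_mul, mul_sub, e2', e3', ← e1']
  generalize Complex.ofRealHom.mapMatrix U * Complex.ofRealHom.mapMatrix G⁻¹ *
    Complex.ofRealHom.mapMatrix U = A
  generalize Complex.ofRealHom.mapMatrix (hod G U) * Complex.ofRealHom.mapMatrix G⁻¹ *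
    Complex.ofRealHom.mapMatrix (hod G U) = B
  ext i j
  simp only [Matrix.smul_apply, Matrix.sub_apply, Matrix.zero_apply, smul_eq_mul]
  linear_combination (A i j - B i j) * hc + (c * c * B i j) * Complex.I_mul_I

theorem codiv_sub_I_mul (S T : Fin 4 → Mat) (l : Fin 4) :
    codiv G (fun k i j => (S k i j : ℂ) - Complex.I * (T k i j : ℂ)) l =
      ((codiv G (fun k => S k) l : ℝ) : ℂ)
        - Complex.I * ((codiv G (fun k => T k) l : ℝ) : ℂ) := by
  simp only [codiv, Complex.real_smul, smul_eq_mul, Complex.ofReal_neg, Complex.ofReal_sum,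
    Complex.ofReal_mul, mul_sub, Finset.sum_sub_distrib, mul_left_comm _ Complex.I,
    ← Finset.mul_sum]
  ring

/-- The Leibniz rule `δ(fF) = f δF - i(df)F`, with `df = f λ`. -/
theorem codiv_mul_add (c : ℂ) (lam : Fin 4 → ℂ) (u : Fin 4 → Fin 4 → ℂ)
    (D : Fin 4 → Fin 4 → Fin 4 → ℂ) (l : Fin 4) :
    codiv G (fun k i j => c * (lam k * u i j + D k i j)) l =
      c * (codiv G D l - inter2 G lam u l) := by
  simp only [codiv, inter2, raise1, Complex.real_smul, mul_sub, mul_neg, Finset.mul_sum,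
    Finset.sum_mul, ← Finset.sum_neg_distrib, ← Finset.sum_sub_distrib]
  exact Finset.sum_congr rfl fun m _ => Finset.sum_congr rfl fun k _ => by ring

/-- The pointwise form of the theorem.  `D_k = ∇_k U`, and `T_k = ∇_k A` where `A = α U + β *U`
with `α + i β = exp (φ + i ψ)`. -/
theorem UnitaryJet.killingYano_iff (hG : G.transpose = G) (hdet : G.det < 0) {U : Mat}
    {D T : Fin 4 → Mat} (h : UnitaryJet G U D) {α β : ℝ} (hαβ : (α : ℂ) + Complex.I * β ≠ 0)
    (dφ dψ : Fin 4 → ℝ) {c : ℂ} (hc : c * c = 1 / 2)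
    (hT : ∀ k, T k = (α * dφ k - β * dψ k) • U + (β * dφ k + α * dψ k) • hod G U
      + α • D k + β • hod G (D k)) {d : Fin 4 → ℂ}
    (hd : ∀ l, d l = c * (((codiv G (fun k => D k) l : ℝ) : ℂ)
      - Complex.I * ((codiv G (fun k => hod G (D k)) l : ℝ) : ℂ))) :
    (∀ k i j, T k i j = -T i k j) ↔
      (∀ k i j, sdPart c G (D k) i j - inter2 G d (sdPart c G U) k * sdPart c G U i j
        - inter4 G d (selfDualMetric G) k i j = 0) ∧
      (∀ k, ((dφ k : ℂ) + Complex.I * dψ k) = -inter2 G d (sdPart c G U) k) ∧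
      ∀ l, α * codiv G (fun k => D k) l + β * codiv G (fun k => hod G (D k)) l = 0 := by
  have hc0 : c ≠ 0 := by rintro rfl; norm_num at hc
  set lam : Fin 4 → ℂ := fun k => (dφ k : ℂ) + Complex.I * dψ k with hlam
  set u := sdPart c G U with hu
  -- Chosen so that `A - i *A = z 𝒰`; being nonzero, `z` cancels from the conformal equation.
  set z : ℂ := ((α : ℂ) + Complex.I * β) / c with hz
  have hz0 : z ≠ 0 := div_ne_zero hαβ hc0
  have hzc : z * c = (α : ℂ) + Complex.I * β := div_mul_cancel₀ _ hc0
  have hTs : ∀ k i j, T k i j = -T k j i := by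
    intro k i j
    simp only [hT, Matrix.add_apply, Matrix.smul_apply, smul_eq_mul, h.skew i j,
      hod_skew _ i j, h.deriv_skew k i j]
    ring
  have hTh : ∀ k, hod G (T k) = (α * dφ k - β * dψ k) • hod G U - (β * dφ k + α * dψ k) • U
      + α • hod G (D k) - β • D k := by
    intro k
    rw [hT]
    simp only [hod_add, hod_smul, hod_hod hG hdet h.skew, hod_hod hG hdet (h.deriv_skew k)]
    simp only [smul_neg, sub_eq_add_neg]
  have hTc : ∀ k i j, (T k i j : ℂ) - Complex.I * (hod G (T k) i j : ℝ) =
      z * (lam k * u i j + sdPart c G (D k) i j) := by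
    intro k i j
    simp only [hTh]
    simp only [hT, Matrix.add_apply, Matrix.sub_apply, Matrix.smul_apply, smul_eq_mul, hu, hlam,
      sdPart]
    push_cast
    generalize ((U i j : ℝ) : ℂ) = x
    generalize ((hod G U i j : ℝ) : ℂ) = y
    generalize ((D k i j : ℝ) : ℂ) = p
    generalize ((hod G (D k) i j : ℝ) : ℂ) = q
    linear_combination (-((dφ k + Complex.I * dψ k) * (x - Complex.I * y)
      + (p - Complex.I * q))) * hzc + (α * dψ k * y + dφ k * β * y - β * dψ k * x
      + β * dψ k * y * Complex.I + β * q) * Complex.I_mul_I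
  have hdD : codiv G (fun k => sdPart c G (D k)) = d := by
    ext l
    rw [hd]
    have := codiv_mul_add (G := G) c (0 : Fin 4 → ℂ) (0 : Fin 4 → Fin 4 → ℂ)
      (fun k i j => ((D k i j : ℝ) : ℂ)
      - Complex.I * ((hod G (D k) i j : ℝ) : ℂ)) l
    rw [codiv_sub_I_mul] at this
    have e : inter2 G (0 : Fin 4 → ℂ) 0 l = 0 := by simp [inter2]
    simp only [Pi.zero_apply, zero_mul, zero_add, e, sub_zero] at this
    exact this
  have hTd : ∀ l, ((codiv G (fun k => T k) l : ℝ) : ℂ)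
      - Complex.I * ((codiv G (fun k => hod G (T k)) l : ℝ) : ℂ) =
      z * (d l - inter2 G lam u l) := by
    intro l
    rw [← codiv_sub_I_mul, ← hdD]
    simp only [hTc]
    exact codiv_mul_add z lam u (fun k => sdPart c G (D k)) l
  have hTdf : (fun l => ((codiv G (fun k => T k) l : ℝ) : ℂ)
      - Complex.I * ((codiv G (fun k => hod G (T k)) l : ℝ) : ℂ)) =
      z • (d - inter2Lin G u lam) := funext hTd
  have hpD : ∀ k, ∑ i, ∑ j, (Complex.ofRealHom.mapMatrix G⁻¹ * u *
      Complex.ofRealHom.mapMatrix G⁻¹) i j * sdPart c G (D k) i j = 0 := by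
    intro k
    rw [sum_sdPart_mul_sdPart hG hdet h.skew (h.deriv_skew k) hc, h.deriv_norm,
      h.deriv_norm_hod]
    simp
  have hpu : ∑ i, ∑ j, (Complex.ofRealHom.mapMatrix G⁻¹ * u *
      Complex.ofRealHom.mapMatrix G⁻¹) i j * u i j = -2 := by
    rw [sum_sdPart_mul_sdPart hG hdet h.skew h.skew hc, h.norm, h.norm_hod]
    simp
  have hpQ : ∀ v k, ∑ i, ∑ j, (Complex.ofRealHom.mapMatrix G⁻¹ * u *
      Complex.ofRealHom.mapMatrix G⁻¹) i j * inter4Lin G (selfDualMetric G) v k i j =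
      2 * inter2Lin G u v k := by
    intro v k
    have e : ∀ i j, (Complex.ofRealHom.mapMatrix G⁻¹ * u * Complex.ofRealHom.mapMatrix G⁻¹) i j *
        inter4Lin G (selfDualMetric G) v k i j = ∑ m, raise1 G v m *
          ((Complex.ofRealHom.mapMatrix G⁻¹ * u * Complex.ofRealHom.mapMatrix G⁻¹) i j *
            selfDualMetric G m k i j) := by
      intro i j
      simp only [inter4Lin, LinearMap.coe_mk, AddHom.coe_mk, inter4, Finset.mul_sum]
      exact Finset.sum_congr rfl fun m _ => by ring
    simp only [e]
    rw [Finset.sum_congr rfl fun i _ => Finset.sum_comm, Finset.sum_comm]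
    simp only [← Finset.mul_sum, hu, sum_sdPart_mul_selfDualMetric hG hdet h.skew, inter2Lin,
      LinearMap.coe_mk, AddHom.coe_mk, inter2]
    rw [Finset.mul_sum]
    exact Finset.sum_congr rfl fun m _ => by ring
  have hI2 : ∀ v, inter2Lin G u (inter2Lin G u v) = (1 / 2 : ℂ) • v := fun v =>
    inter2_inter2 hG hdet (sdPart_mul_sdPart hG hdet h.skew h.norm h.norm_hod hc) v
  have core := conformalKilling_iff (lam := lam) (d := d) (D := fun k => sdPart c G (D k))
    (inter2Lin G u) (inter4Lin G (selfDualMetric G)) hpu hpD hpQ hI2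
  have hcK : (∀ k i j, (T k i j : ℂ) - Complex.I * (hod G (T k) i j : ℝ) = (2 / 3 : ℂ) *
        inter4 G (fun l => ((codiv G (fun k => T k) l : ℝ) : ℂ) - Complex.I *
          ((codiv G (fun k => hod G (T k)) l : ℝ) : ℂ)) (selfDualMetric G) k i j) ↔
      ∀ k i j, lam k * u i j + sdPart c G (D k) i j =
        (2 / 3) * inter4Lin G (selfDualMetric G) (d - inter2Lin G u lam) k i j := by
    refine forall_congr' fun k => forall_congr' fun i => forall_congr' fun j => ?_
    have e : inter4 G (z • (d - inter2Lin G u lam)) (selfDualMetric G) k i j =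
        z * inter4Lin G (selfDualMetric G) (d - inter2Lin G u lam) k i j :=
      congrFun (congrFun (congrFun
        ((inter4Lin G (selfDualMetric G)).map_smul z (d - inter2Lin G u lam)) k) i) j
    rw [hTc, hTdf, e, mul_left_comm, mul_right_inj' hz0]
  -- Here `d - i(λ)𝒰 = (3/2) d`, so `δA` is `3/2` times the real part of `(α + iβ)(δU - i δ*U)`.
  have hre : lam = -inter2Lin G u d → ∀ l, codiv G (fun k => T k) l = (3 / 2) *
      (α * codiv G (fun k => D k) l + β * codiv G (fun k => hod G (D k)) l) := by
    intro hl l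
    have h1 := hTd l
    have h2 : inter2 G lam u l = -(1 / 2) * d l := by
      have : inter2Lin G u lam = (-(1 / 2) : ℂ) • d := by rw [hl, map_neg, hI2, neg_smul]
      exact congrFun this l
    rw [h2, hd] at h1
    have h3 : ((codiv G (fun k => T k) l : ℝ) : ℂ)
        - Complex.I * ((codiv G (fun k => hod G (T k)) l : ℝ) : ℂ) =
        (3 / 2) * (((α : ℂ) + Complex.I * β) * (((codiv G (fun k => D k) l : ℝ) : ℂ)
          - Complex.I * ((codiv G (fun k => hod G (D k)) l : ℝ) : ℂ))) := by
      rw [h1, ← hzc]; ring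
    have h4 := congrArg Complex.re h3
    simp at h4
    linarith
  rw [Spacetime.killingYano_iff hG hdet hTs, hcK, core]
  constructor
  · rintro ⟨h0, hS, hl⟩
    refine ⟨hS, fun k => congrFun hl k, fun l => ?_⟩
    have := hre hl l
    rw [h0] at this
    linarith
  · rintro ⟨hS, hl, h0⟩
    have hl' : lam = -inter2Lin G u d := funext hl
    exact ⟨fun l => by rw [hre hl', h0, mul_zero], hS, hl'⟩

end Pointwise

/-! ### Partial derivatives of matrix fields. -/

section Derivatives

variable {V W : Type*} [NormedAddCommGroup V] [NormedSpace ℝ V] [NormedAddCommGroup W]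
  [NormedSpace ℝ W]

theorem pd_add (k : Fin 4) {f h : E4 → V} {y : E4} (hf : DifferentiableAt ℝ f y)
    (hh : DifferentiableAt ℝ h y) : pd k (fun z => f z + h z) y = pd k f y + pd k h y := by
  simp [pd, fderiv_fun_add hf hh]

theorem pd_mul (k : Fin 4) {f h : E4 → ℝ} {y : E4} (hf : DifferentiableAt ℝ f y)
    (hh : DifferentiableAt ℝ h y) :
    pd k (fun z => f z * h z) y = pd k f y * h y + f y * pd k h y := by
  simp [pd, fderiv_fun_mul hf hh]; ring

theorem pd_const (k : Fin 4) (c : V) (y : E4) : pd k (fun _ => c) y = 0 := by simp [pd]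

theorem pd_neg (k : Fin 4) (f : E4 → V) (y : E4) : pd k (fun z => -f z) y = -pd k f y := by
  simp [pd, fderiv_fun_neg]

theorem pd_sum (k : Fin 4) {ι : Type*} (s : Finset ι) {f : ι → E4 → V} {y : E4}
    (hf : ∀ i ∈ s, DifferentiableAt ℝ (f i) y) :
    pd k (fun z => ∑ i ∈ s, f i z) y = ∑ i ∈ s, pd k (f i) y := by
  simp [pd, fderiv_fun_sum hf]

theorem pd_congr (k : Fin 4) {f h : E4 → V} {y : E4} (hfh : f =ᶠ[nhds y] h) :
    pd k f y = pd k h y := by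
  simp [pd, hfh.fderiv_eq]

theorem pd_clm (k : Fin 4) (L : V →L[ℝ] W) {f : E4 → V} {y : E4} (hf : DifferentiableAt ℝ f y) :
    pd k (fun z => L (f z)) y = L (pd k f y) := by
  have h : HasFDerivAt (fun z => L (f z)) (L.comp (fderiv ℝ f y)) y :=
    L.hasFDerivAt.comp y hf.hasFDerivAt
  simp [pd, h.fderiv]

theorem pd_eq_of_hasDerivAt (k : Fin 4) {f : E4 → ℝ} {y : E4} {f' : ℝ}
    (hf : DifferentiableAt ℝ f y)
    (h : HasDerivAt (fun t : ℝ => f (y + t • EuclideanSpace.single k (1 : ℝ))) f' 0) :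
    pd k f y = f' :=
  (hf.hasFDerivAt.hasLineDerivAt (EuclideanSpace.single k (1 : ℝ))).unique h

theorem hasDerivAt_line (k : Fin 4) {f : E4 → ℝ} {y : E4} (hf : DifferentiableAt ℝ f y) :
    HasDerivAt (fun t : ℝ => f (y + t • EuclideanSpace.single k (1 : ℝ))) (pd k f y) 0 :=
  hf.hasFDerivAt.hasLineDerivAt (EuclideanSpace.single k (1 : ℝ))

/-- Entrywise differentiability of a matrix field. -/
def DiffMat (F : E4 → Mat) (y : E4) : Prop := ∀ i j, DifferentiableAt ℝ (fun z => F z i j) y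

/-- The entrywise partial derivative of a matrix field. -/
def pdMat (k : Fin 4) (F : E4 → Mat) (y : E4) : Mat := fun i j => pd k (fun z => F z i j) y

variable {F H : E4 → Mat} {y : E4}

theorem DiffMat.mul (hF : DiffMat F y) (hH : DiffMat H y) : DiffMat (fun z => F z * H z) y := by
  intro i j
  simp only [Matrix.mul_apply]
  exact DifferentiableAt.fun_sum fun m _ => (hF i m).mul (hH m j)

theorem pdMat_mul (hF : DiffMat F y) (hH : DiffMat H y) (k : Fin 4) :
    pdMat k (fun z => F z * H z) y = pdMat k F y * H y + F y * pdMat k H y := by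
  ext i j
  simp only [pdMat, Matrix.mul_apply, Matrix.add_apply]
  rw [pd_sum k _ fun m _ => (hF i m).fun_mul (hH m j), ← Finset.sum_add_distrib]
  exact Finset.sum_congr rfl fun m _ => pd_mul k (hF i m) (hH m j)

theorem DiffMat.smul {f : E4 → ℝ} (hf : DifferentiableAt ℝ f y) (hF : DiffMat F y) :
    DiffMat (fun z => f z • F z) y := fun i j => hf.mul (hF i j)

theorem pdMat_smul {f : E4 → ℝ} (hf : DifferentiableAt ℝ f y) (hF : DiffMat F y) (k : Fin 4) :
    pdMat k (fun z => f z • F z) y = pd k f y • F y + f y • pdMat k F y := by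
  ext i j
  exact pd_mul k hf (hF i j)

theorem DiffMat.dual (hF : DiffMat F y) : DiffMat (fun z => dual (F z)) y := by
  intro i j
  exact (DifferentiableAt.fun_sum fun a _ => DifferentiableAt.fun_sum fun b _ =>
    (hF a b).const_mul _).const_mul _

theorem pd_const_mul (k : Fin 4) (c : ℝ) {f : E4 → ℝ} (hf : DifferentiableAt ℝ f y) :
    pd k (fun z => c * f z) y = c * pd k f y := by
  rw [pd_mul k (differentiableAt_const c) hf, pd_const]; ring

theorem pdMat_dual (hF : DiffMat F y) (k : Fin 4) :
    pdMat k (fun z => Spacetime.dual (F z)) y = Spacetime.dual (pdMat k F y) := by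
  ext i j
  simp only [pdMat, Spacetime.dual]
  have h1 : ∀ a b, DifferentiableAt ℝ (fun z => levi a b i j * F z a b) y :=
    fun a b => (hF a b).const_mul _
  have h2 : ∀ a, DifferentiableAt ℝ (fun z => ∑ b, levi a b i j * F z a b) y :=
    fun a => DifferentiableAt.fun_sum fun b _ => h1 a b
  rw [pd_const_mul k _ (DifferentiableAt.fun_sum fun a _ => h2 a), pd_sum k _ fun a _ => h2 a]
  congr 1
  refine Finset.sum_congr rfl fun a _ => ?_
  rw [pd_sum k _ fun b _ => h1 a b]
  exact Finset.sum_congr rfl fun b _ => pd_const_mul k _ (hF a b)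

theorem DiffMat.trace (hF : DiffMat F y) : DifferentiableAt ℝ (fun z => (F z).trace) y :=
  DifferentiableAt.fun_sum fun i _ => hF i i

theorem pd_trace (hF : DiffMat F y) (k : Fin 4) :
    pd k (fun z => (F z).trace) y = (pdMat k F y).trace :=
  pd_sum k _ fun i _ => hF i i

theorem DiffMat.det (hF : DiffMat F y) : DifferentiableAt ℝ (fun z => (F z).det) y := by
  have h := hF
  simp only [DiffMat] at h
  simp only [det_four]
  fun_prop

theorem DiffMat.inv (hF : DiffMat F y) (h0 : (F y).det ≠ 0) : DiffMat (fun z => (F z)⁻¹) y := by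
  intro i j
  simp only [Matrix.inv_def, Matrix.smul_apply, smul_eq_mul, Ring.inverse_eq_inv']
  refine (hF.det.inv h0).mul ?_
  simp only [Matrix.adjugate_apply]
  refine DiffMat.det (F := fun z => (F z).updateRow j (Pi.single i 1)) fun a b => ?_
  by_cases h : a = j
  · subst h; simp
  · simpa [Matrix.updateRow_ne h] using hF a b

theorem pdMat_inv (hF : DiffMat F y) (h0 : (F y).det ≠ 0) (k : Fin 4) :
    pdMat k (fun z => (F z)⁻¹) y = -((F y)⁻¹ * pdMat k F y * (F y)⁻¹) := by
  have hev : ∀ᶠ z in nhds y, (F z).det ≠ 0 := hF.det.continuousAt.eventually_ne h0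
  have h1 : pdMat k (fun z => (F z)⁻¹ * F z) y = 0 := by
    ext i j
    have : (fun z => ((F z)⁻¹ * F z) i j) =ᶠ[nhds y] fun _ => (1 : Mat) i j := by
      filter_upwards [hev] with z hz
      rw [Matrix.nonsing_inv_mul _ hz.isUnit]
    simp only [pdMat, pd_congr k this, pd_const, Matrix.zero_apply]
  rw [pdMat_mul (hF.inv h0) hF] at h1
  have h2 := congrArg (fun M => M * (F y)⁻¹) h1
  simp only [add_mul, zero_mul, Matrix.mul_nonsing_inv_cancel_right _ _ h0.isUnit] at h2
  exact eq_neg_of_add_eq_zero_left h2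

/-- Jacobi's formula for a derivative of the shape `Nᵀ F + F N`. This shape involves no inverse, so
the claim is a polynomial identity after the product rule. -/
theorem pd_det_of_pdMat_eq (hF : DiffMat F y) (k : Fin 4) {N : Mat}
    (hN : pdMat k F y = N.transpose * F y + F y * N) :
    pd k (fun z => (F z).det) y = 2 * N.trace * (F y).det := by
  refine pd_eq_of_hasDerivAt k hF.det ?_
  simp only [det_four]
  let γ : ℝ → E4 := fun t => y + t • EuclideanSpace.single k (1 : ℝ)
  have hγ : γ 0 = y := by simp [γ]
  have h : ∀ i j, HasDerivAt (fun t : ℝ => F (γ t) i j)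
      ((N.transpose * F y + F y * N) i j) 0 := fun i j => by
    rw [← hN]; exact hasDerivAt_line k (hF i j)
  have d2 : ∀ a b c d, HasDerivAt (fun t : ℝ =>
      F (γ t) a b * F (γ t) c d
      - F (γ t) a d * F (γ t) c b) _ 0 :=
    fun a b c d => ((h a b).mul (h c d)).sub ((h a d).mul (h c b))
  have d3 : ∀ a b c, HasDerivAt (fun t : ℝ =>
      F (γ t) 1 a * (F (γ t) 2 b * F (γ t) 3 c
        - F (γ t) 2 c * F (γ t) 3 b)
      - F (γ t) 1 b * (F (γ t) 2 a * F (γ t) 3 c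
        - F (γ t) 2 c * F (γ t) 3 a)
      + F (γ t) 1 c * (F (γ t) 2 a * F (γ t) 3 b
        - F (γ t) 2 b * F (γ t) 3 a)) _ 0 :=
    fun a b c => (((h 1 a).mul (d2 2 b 3 c)).sub ((h 1 b).mul (d2 2 a 3 c))).add
      ((h 1 c).mul (d2 2 a 3 b))
  have d4 := ((((h 0 0).mul (d3 1 2 3)).sub ((h 0 1).mul (d3 0 2 3))).add
    ((h 0 2).mul (d3 0 1 3))).sub ((h 0 3).mul (d3 0 1 2))
  refine HasDerivAt.congr_deriv d4 ?_
  simp only [hγ, Matrix.add_apply, Matrix.mul_apply, Matrix.transpose_apply,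
    Fin.sum_univ_four, Matrix.trace, Matrix.diag_apply]
  ring

end Derivatives

/-! ### The Levi-Civita connection, the Hodge dual and the codifferential. -/

section Metric

variable {g : E4 → Mat} {F H : E4 → Mat} {y : E4}

/-- The connection matrix `N^l_i = Γ^l_{ki}`. -/
def connMat (g : E4 → Mat) (y : E4) (k : Fin 4) : Mat := fun l i => christoffel g y l k i

/-- The covariant derivative `∇_k F` as a matrix. -/
def nablaMat (g : E4 → Mat) (F : E4 → Mat) (y : E4) (k : Fin 4) : Mat :=
  fun i j => nabla g (fun z => F z) y k i j

theorem nablaMat_eq (k : Fin 4) : nablaMat g F y k =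
    pdMat k F y - (connMat g y k).transpose * F y - F y * connMat g y k := by
  ext i j
  simp only [nablaMat, nabla, pdMat, connMat, Matrix.sub_apply, Matrix.mul_apply,
    Matrix.transpose_apply, smul_eq_mul]
  congr 1
  exact Finset.sum_congr rfl fun l _ => mul_comm _ _

theorem pdMat_eq (k : Fin 4) : pdMat k F y =
    nablaMat g F y k + (connMat g y k).transpose * F y + F y * connMat g y k := by
  rw [nablaMat_eq]; abel

theorem christoffel_symm (hg : ∀ z, (g z).transpose = g z) (l i j : Fin 4) :
    christoffel g y l i j = christoffel g y l j i := by
  have h : ∀ i j, (fun z => g z i j) = fun z => g z j i := fun i j =>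
    funext fun z => congrFun (congrFun (hg z) j) i
  simp only [christoffel]
  congr 1
  refine Finset.sum_congr rfl fun m _ => ?_
  rw [h i j]; ring

/-- Metric compatibility of the Levi-Civita connection. -/
theorem pdMat_metric (hg : ∀ z, (g z).transpose = g z) (hdet : (g y).det ≠ 0) (k : Fin 4) :
    pdMat k g y = (connMat g y k).transpose * g y + g y * connMat g y k := by
  have h : ∀ i j, (fun z => g z i j) = fun z => g z j i := fun i j =>
    funext fun z => congrFun (congrFun (hg z) j) i
  have hlow : ∀ i j, (g y * connMat g y k) i j = (1 / 2) * (pd k (fun z => g z i j) y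
      + pd j (fun z => g z i k) y - pd i (fun z => g z k j) y) := by
    intro i j
    have e : connMat g y k = (1 / 2 : ℝ) • ((g y)⁻¹ * Matrix.of fun m j =>
        pd k (fun z => g z m j) y + pd j (fun z => g z m k) y - pd m (fun z => g z k j) y) := by
      ext l j
      simp [connMat, christoffel, Matrix.mul_apply]
    rw [e, Matrix.mul_smul, Matrix.mul_nonsing_inv_cancel_left _ _ hdet.isUnit]
    rfl
  have ht : (connMat g y k).transpose * g y = (g y * connMat g y k).transpose := by
    rw [Matrix.transpose_mul, hg]
  ext i j
  rw [ht, Matrix.add_apply, Matrix.transpose_apply, hlow, hlow, h j i, h k i, h i k, h j k]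
  simp only [pdMat, h k j]
  ring

theorem pdMat_inv_metric (hg : ∀ z, (g z).transpose = g z) (hgd : DiffMat g y)
    (hdet : (g y).det ≠ 0) (k : Fin 4) :
    pdMat k (fun z => (g z)⁻¹) y =
      -((g y)⁻¹ * (connMat g y k).transpose) - connMat g y k * (g y)⁻¹ := by
  rw [pdMat_inv hgd hdet, pdMat_metric hg hdet, mul_add, add_mul, ← Matrix.mul_assoc (g y)⁻¹,
    Matrix.mul_nonsing_inv_cancel_right _ _ hdet.isUnit,
    Matrix.nonsing_inv_mul_cancel_left _ _ hdet.isUnit]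
  abel

theorem pd_volume (hg : ∀ z, (g z).transpose = g z) (hgd : DiffMat g y) (hdet : (g y).det < 0)
    (k : Fin 4) : DifferentiableAt ℝ (fun z => Real.sqrt |(g z).det|) y ∧
      pd k (fun z => Real.sqrt |(g z).det|) y =
        (connMat g y k).trace * Real.sqrt |(g y).det| := by
  have hev : (fun z => Real.sqrt |(g z).det|) =ᶠ[nhds y] fun z => Real.sqrt (-(g z).det) := by
    filter_upwards [hgd.det.continuousAt.eventually_lt continuousAt_const hdet] with z hz
    rw [abs_of_neg hz]
  have hd : DifferentiableAt ℝ (fun z => Real.sqrt (-(g z).det)) y :=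
    hgd.det.neg.sqrt (by simpa using hdet.ne)
  have hd' : DifferentiableAt ℝ (fun z => Real.sqrt |(g z).det|) y := hd.congr_of_eventuallyEq hev
  refine ⟨hd', ?_⟩
  -- Differentiating the square replaces the derivative of the root by that of the determinant; the
  -- positive factor `2√|det g|` is then cancelled.
  have hsq : (fun z => Real.sqrt |(g z).det| * Real.sqrt |(g z).det|) =ᶠ[nhds y]
      fun z => -(g z).det := by
    filter_upwards [hgd.det.continuousAt.eventually_lt continuousAt_const hdet] with z hz
    exact sqrt_det_sq hz
  have h1 := pd_congr k hsq
  rw [pd_mul k hd' hd', pd_neg, pd_det_of_pdMat_eq hgd k (pdMat_metric hg hdet.ne k)] at h1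
  have hpos : 0 < Real.sqrt |(g y).det| := Real.sqrt_pos.2 (abs_pos.2 hdet.ne)
  have h2 := sqrt_det_sq hdet
  have h3 : 2 * Real.sqrt |(g y).det| * (pd k (fun z => Real.sqrt |(g z).det|) y -
      (connMat g y k).trace * Real.sqrt |(g y).det|) = 0 := by
    linear_combination h1 - 2 * (connMat g y k).trace * h2
  have h4 := (mul_eq_zero.1 h3).resolve_left (by positivity)
  linarith

theorem DiffMat.raise (hgd : DiffMat g y) (hdet : (g y).det ≠ 0) (hF : DiffMat F y) :
    DiffMat (fun z => (g z)⁻¹ * F z * (g z)⁻¹) y :=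
  ((hgd.inv hdet).mul hF).mul (hgd.inv hdet)

theorem pdMat_raise (hg : ∀ z, (g z).transpose = g z) (hgd : DiffMat g y)
    (hdet : (g y).det ≠ 0) (hF : DiffMat F y) (k : Fin 4) :
    pdMat k (fun z => (g z)⁻¹ * F z * (g z)⁻¹) y =
      (g y)⁻¹ * nablaMat g F y k * (g y)⁻¹
        - (connMat g y k * ((g y)⁻¹ * F y * (g y)⁻¹)
          + (g y)⁻¹ * F y * (g y)⁻¹ * (connMat g y k).transpose) := by
  rw [pdMat_mul ((hgd.inv hdet).mul hF) (hgd.inv hdet), pdMat_mul (hgd.inv hdet) hF,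
    pdMat_inv_metric hg hgd hdet, pdMat_eq (g := g) (F := F)]
  noncomm_ring

theorem DiffMat.hod (hg : ∀ z, (g z).transpose = g z) (hgd : DiffMat g y) (hdet : (g y).det < 0)
    (hF : DiffMat F y) : DiffMat (fun z => hod (g z) (F z)) y :=
  DiffMat.smul (pd_volume hg hgd hdet 0).1 (hgd.raise hdet.ne hF).dual

/-- The covariant derivative commutes with the Hodge dual. -/
theorem nablaMat_hod (hg : ∀ z, (g z).transpose = g z) (hgd : DiffMat g y)
    (hdet : (g y).det < 0) (hF : DiffMat F y) (hs : ∀ i j, F y i j = -F y j i) (k : Fin 4) :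
    nablaMat g (fun z => hod (g z) (F z)) y k = hod (g y) (nablaMat g F y k) := by
  have hv := pd_volume hg hgd hdet k
  have hP := dual_derivation (raise_skew (hg y) hs) (connMat g y k)
  have h1 : pdMat k (fun z => hod (g z) (F z)) y = _ :=
    pdMat_smul hv.1 (hgd.raise hdet.ne hF).dual k
  rw [nablaMat_eq, h1, pdMat_dual (hgd.raise hdet.ne hF), pdMat_raise hg hgd hdet.ne hF, hv.2]
  simp only [Spacetime.hod, sub_eq_add_neg, dual_add, dual_neg] at hP ⊢
  generalize Spacetime.dual ((g y)⁻¹ * F y * (g y)⁻¹) = X at *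
  generalize Spacetime.dual ((g y)⁻¹ * nablaMat g F y k * (g y)⁻¹) = Y at *
  generalize Spacetime.dual (connMat g y k * ((g y)⁻¹ * F y * (g y)⁻¹)) = A at *
  generalize Spacetime.dual ((g y)⁻¹ * F y * (g y)⁻¹ * (connMat g y k).transpose) = B at *
  have h2 := congrArg (fun M => Real.sqrt |(g y).det| • M) hP
  simp only [smul_add, smul_neg, smul_smul, neg_add] at h2
  simp only [smul_add, smul_neg, Matrix.mul_smul, Matrix.smul_mul, neg_add]
  rw [mul_comm (connMat g y k).trace]
  have h3 : (Real.sqrt |(g y).det| * (connMat g y k).trace) • X =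
    Real.sqrt |(g y).det| • ((connMat g y k).transpose * X) +
    Real.sqrt |(g y).det| • (X * connMat g y k) + (Real.sqrt |(g y).det| • A
      + Real.sqrt |(g y).det| • B) := by
    rw [← h2]; abel
  rw [h3]; abel

/-- A full contraction is a scalar, so its partial derivative is the covariant one: the connection
terms cancel by cyclicity of the trace. -/
theorem trace_deriv_eq_zero (hg : ∀ z, (g z).transpose = g z) (hgd : DiffMat g y)
    (hdet : (g y).det ≠ 0) (hF : DiffMat F y) (hH : DiffMat H y) {c : ℝ}
    (hc : ∀ᶠ z in nhds y, ((g z)⁻¹ * F z * (g z)⁻¹ * H z).trace = c) (k : Fin 4) :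
    ((g y)⁻¹ * nablaMat g F y k * (g y)⁻¹ * H y).trace +
      ((g y)⁻¹ * F y * (g y)⁻¹ * nablaMat g H y k).trace = 0 := by
  have h1 : pd k (fun z => ((g z)⁻¹ * F z * (g z)⁻¹ * H z).trace) y = 0 := by
    rw [pd_congr k (h := fun _ => c) hc, pd_const]
  rw [pd_trace ((hgd.raise hdet hF).mul hH), pdMat_mul (hgd.raise hdet hF) hH,
    pdMat_raise hg hgd hdet hF, pdMat_eq (g := g) (F := H)] at h1
  generalize (g y)⁻¹ * nablaMat g F y k * (g y)⁻¹ = A at *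
  generalize (g y)⁻¹ * F y * (g y)⁻¹ = P at *
  generalize connMat g y k = N at *
  simp only [sub_mul, add_mul, mul_add, Matrix.trace_add, Matrix.trace_sub] at h1
  have e1 : (N * P * H y).trace = (P * (H y * N)).trace := by
    rw [Matrix.mul_assoc, Matrix.trace_mul_comm, Matrix.mul_assoc]
  have e2 : (P * N.transpose * H y).trace = (P * (N.transpose * H y)).trace := by
    rw [Matrix.mul_assoc]
  linarith

theorem nablaMat_skew (hF : ∀ z i j, F z i j = -F z j i) (k i j : Fin 4) :
    nablaMat g F y k i j = -nablaMat g F y k j i := by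
  have h : ∀ i j, pd k (fun z => F z i j) y = -pd k (fun z => F z j i) y := by
    intro i j
    rw [← pd_neg]
    congr 1
    exact funext fun z => hF z i j
  simp only [nablaMat, nabla, smul_eq_mul]
  rw [h i j]
  simp only [hF y _ j, hF y i, mul_neg, Finset.sum_neg_distrib]
  ring

/-- The connection is torsion-free: symmetric Christoffel symbols cancel in the cyclic sum against
the skew form. -/
theorem extd2_eq_nabla (hg : ∀ z, (g z).transpose = g z) (hF : ∀ z i j, F z i j = -F z j i)
    (i j k : Fin 4) : extd2 (fun z => F z) y i j k =
      nablaMat g F y i j k + nablaMat g F y j k i + nablaMat g F y k i j := by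
  simp only [extd2, nablaMat, nabla, smul_eq_mul, christoffel_symm hg _ j i,
    christoffel_symm hg _ k j, christoffel_symm hg _ k i]
  have e : ∀ a b c, ∑ l, christoffel g y l a b * F y c l =
      -∑ l, christoffel g y l a b * F y l c := by
    intro a b c
    rw [← Finset.sum_neg_distrib]
    exact Finset.sum_congr rfl fun l _ => by rw [hF y c l]; ring
  simp only [e]
  ring

theorem raise3_cycle (G : Mat) (S : Fin 4 → Fin 4 → Fin 4 → ℝ) (i j k : Fin 4) :
    raise3 G (fun a b c => S a b c + S b c a + S c a b) i j k =
      raise3 G S i j k + raise3 G S j k i + raise3 G S k i j := by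
  have h1 : raise3 G S j k i = ∑ a, ∑ b, ∑ c, (G⁻¹ i a * G⁻¹ j b * G⁻¹ k c) * S b c a := by
    simp only [raise3, smul_eq_mul]
    rw [Finset.sum_congr rfl fun a _ => Finset.sum_comm, Finset.sum_comm]
    refine Finset.sum_congr rfl fun a _ => Finset.sum_congr rfl fun b _ =>
      Finset.sum_congr rfl fun c _ => by ring
  have h2 : raise3 G S k i j = ∑ a, ∑ b, ∑ c, (G⁻¹ i a * G⁻¹ j b * G⁻¹ k c) * S c a b := by
    simp only [raise3, smul_eq_mul]
    rw [Finset.sum_comm, Finset.sum_congr rfl fun a _ => Finset.sum_comm]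
    refine Finset.sum_congr rfl fun a _ => Finset.sum_congr rfl fun b _ =>
      Finset.sum_congr rfl fun c _ => by ring
  rw [h1, h2]
  simp only [raise3, smul_eq_mul, mul_add, Finset.sum_add_distrib]

theorem sum_rotate (f : Fin 4 → Fin 4 → Fin 4 → ℝ) :
    ∑ i, ∑ j, ∑ k, f j k i = ∑ i, ∑ j, ∑ k, f i j k := by
  rw [Finset.sum_comm]
  exact Finset.sum_congr rfl fun i _ => Finset.sum_comm

/-- `η` is invariant under rotation of its first three indices, so the three cyclic terms agree, and
`3 · 1/6` is the factor `1/2` of the dual of a 2-form. -/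
theorem hodge3_cycle (G : Mat) (S : Fin 4 → Mat) (hG : G.transpose = G) (l : Fin 4) :
    hodge3 G (fun a b c => S a b c + S b c a + S c a b) l =
      ∑ m, ∑ k, G⁻¹ m k * hod G (S k) m l := by
  have hη : ∀ i j k, eta G j k i l = eta G i j k l := fun i j k => by
    rw [eta, eta, levi_rotate]
  have hrot : ∀ Z : Fin 4 → Fin 4 → Fin 4 → ℝ,
      ∑ i, ∑ j, ∑ k, eta G i j k l * (Z i j k + Z j k i + Z k i j) =
        3 * ∑ i, ∑ j, ∑ k, eta G i j k l * Z i j k := by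
    intro Z
    have h1 : ∑ i, ∑ j, ∑ k, eta G i j k l * Z j k i =
        ∑ i, ∑ j, ∑ k, eta G i j k l * Z i j k := by
      rw [← sum_rotate fun i j k => eta G i j k l * Z i j k]
      simp only [hη]
    have h2 : ∑ i, ∑ j, ∑ k, eta G i j k l * Z k i j =
        ∑ i, ∑ j, ∑ k, eta G i j k l * Z i j k := by
      rw [← sum_rotate fun i j k => eta G i j k l * Z k i j]
      simp only [hη]
    simp only [mul_add, Finset.sum_add_distrib, h1, h2]
    ring
  have hr : ∀ i j k, raise3 G (fun a b c => S a b c) i j k =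
      ∑ a, G⁻¹ i a * (G⁻¹ * S a * G⁻¹) j k := by
    intro i j k
    simp only [raise3, ← raise2_eq hG]
    simp only [raise2, smul_eq_mul, Finset.mul_sum, mul_assoc]
  simp only [hodge3, smul_eq_mul, raise3_cycle G (fun a b c => S a b c)]
  rw [hrot]
  simp only [hr, hod, dual, Matrix.smul_apply, eta, Finset.mul_sum, smul_eq_mul]
  refine Finset.sum_congr rfl fun m _ => ?_
  rw [Finset.sum_congr rfl fun i _ => Finset.sum_comm, Finset.sum_comm]
  refine Finset.sum_congr rfl fun k _ => Finset.sum_congr rfl fun i _ =>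
    Finset.sum_congr rfl fun j _ => ?_
  rw [levi_rotate m i j l]
  ring

theorem star_eq_hod (hg : ∀ z, (g z).transpose = g z) :
    star g (fun z => F z) = fun z => hod (g z) (F z) := by
  ext z k l
  exact hodge2_eq_hod (hg z) (F z) k l

/-- `(δF)_l = -∇^a F_{al}`. -/
theorem codiff_eq_codiv (hg : ∀ z, (g z).transpose = g z) (hgd : DiffMat g y)
    (hdet : (g y).det < 0) (hFd : DiffMat F y) (hF : ∀ z i j, F z i j = -F z j i) (l : Fin 4) :
    codiff g (fun z => F z) y l = codiv (g y) (fun k => nablaMat g F y k) l := by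
  have hn : nablaMat g (fun z => hod (g z) (F z)) y = fun k => hod (g y) (nablaMat g F y k) :=
    funext fun k => nablaMat_hod hg hgd hdet hFd (hF y) k
  have he : extd2 (star g fun z => F z) y = fun a b c =>
      hod (g y) (nablaMat g F y a) b c + hod (g y) (nablaMat g F y b) c a
        + hod (g y) (nablaMat g F y c) a b := by
    ext a b c
    rw [star_eq_hod hg, extd2_eq_nabla hg (F := fun z => hod (g z) (F z))
      (fun z => hod_skew (F z)), hn]
  change hodge3 (g y) (extd2 (star g fun z => F z) y) l = _
  rw [he, hodge3_cycle (g y) (fun k => hod (g y) (nablaMat g F y k)) (hg y)]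
  change _ = -∑ m, ∑ k, (g y)⁻¹ m k * nablaMat g F y k m l
  rw [← Finset.sum_neg_distrib]
  refine Finset.sum_congr rfl fun m _ => ?_
  rw [← Finset.sum_neg_distrib]
  refine Finset.sum_congr rfl fun k _ => ?_
  -- The minus sign of the divergence formula is that of `** = -1`.
  rw [hod_hod (hg y) hdet (nablaMat_skew hF k)]
  simp

end Metric

/-! ### Linear maps of the values: from real to complex tensors. -/

section ContinuousLinearMap

variable {V W : Type*} [NormedAddCommGroup V] [NormedSpace ℝ V] [NormedAddCommGroup W]
  [NormedSpace ℝ W] (L : V →L[ℝ] W) {g : E4 → Mat} {F : E4 → Fin 4 → Fin 4 → V} {y : E4}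

theorem hodge2_clm (G : Mat) (F : Fin 4 → Fin 4 → V) :
    hodge2 G (fun i j => L (F i j)) = fun k l => L (hodge2 G F k l) := by
  ext k l; simp [hodge2, raise2, map_sum]

theorem hodge3_clm (G : Mat) (C : Fin 4 → Fin 4 → Fin 4 → V) (l : Fin 4) :
    hodge3 G (fun i j k => L (C i j k)) l = L (hodge3 G C l) := by
  simp [hodge3, raise3, map_sum]

theorem star_clm : star g (fun z i j => L (F z i j)) = fun z i j => L (star g F z i j) :=
  funext fun z => hodge2_clm L (g z) (F z)

theorem nabla_clm (hF : ∀ i j, DifferentiableAt ℝ (fun z => F z i j) y) (k i j : Fin 4) :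
    nabla g (fun z i j => L (F z i j)) y k i j = L (nabla g F y k i j) := by
  simp [nabla, pd_clm k L (hF i j), map_sum]

theorem codiff_clm (hF : ∀ i j, DifferentiableAt ℝ (fun z => star g F z i j) y) (l : Fin 4) :
    codiff g (fun z i j => L (F z i j)) y l = L (codiff g F y l) := by
  rw [codiff, star_clm, codiff, ← hodge3_clm]
  congr 1
  ext i j k
  simp [extd2, pd_clm _ L (hF _ _)]

end ContinuousLinearMap

/-- The real-linear map `(a, b) ↦ c (a - i b)`. -/
def complexPair (c : ℂ) : ℝ × ℝ →L[ℝ] ℂ :=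
  c • (Complex.ofRealCLM.comp (ContinuousLinearMap.fst ℝ ℝ ℝ)
    - Complex.I • Complex.ofRealCLM.comp (ContinuousLinearMap.snd ℝ ℝ ℝ))

theorem complexPair_apply (c : ℂ) (x : ℝ × ℝ) :
    complexPair c x = c * ((x.1 : ℂ) - Complex.I * (x.2 : ℂ)) := by
  simp [complexPair]

section Pair

variable {g : E4 → Mat} {F H : E4 → Fin 4 → Fin 4 → ℝ} {y : E4}

/-- The pair `(F, H)` is treated as one tensor with values in `ℝ × ℝ`; its images under the two
projections and under `complexPair c` are compared. -/
theorem nabla_complexPair (c : ℂ) (hF : ∀ i j, DifferentiableAt ℝ (fun z => F z i j) y)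
    (hH : ∀ i j, DifferentiableAt ℝ (fun z => H z i j) y) (k i j : Fin 4) :
    nabla g (fun z i j => c * ((F z i j : ℂ) - Complex.I * (H z i j : ℂ))) y k i j =
      c * (((nabla g F y k i j : ℝ) : ℂ) - Complex.I * ((nabla g H y k i j : ℝ) : ℂ)) := by
  have hp : ∀ i j, DifferentiableAt ℝ (fun z => (F z i j, H z i j)) y := fun i j =>
    (hF i j).prodMk (hH i j)
  have h1 := nabla_clm (g := g) (complexPair c) (F := fun z i j => (F z i j, H z i j)) hp k i j
  have h2 := nabla_clm (g := g) (ContinuousLinearMap.fst ℝ ℝ ℝ)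
    (F := fun z i j => (F z i j, H z i j)) hp k i j
  have h3 := nabla_clm (g := g) (ContinuousLinearMap.snd ℝ ℝ ℝ)
    (F := fun z i j => (F z i j, H z i j)) hp k i j
  simp only [complexPair_apply] at h1
  rw [h1]
  simp only [ContinuousLinearMap.coe_fst', ContinuousLinearMap.coe_snd'] at h2 h3
  rw [← h2, ← h3]

theorem codiff_complexPair (c : ℂ) (hF : ∀ i j, DifferentiableAt ℝ (fun z => star g F z i j) y)
    (hH : ∀ i j, DifferentiableAt ℝ (fun z => star g H z i j) y) (l : Fin 4) :
    codiff g (fun z i j => c * ((F z i j : ℂ) - Complex.I * (H z i j : ℂ))) y l =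
      c * (((codiff g F y l : ℝ) : ℂ) - Complex.I * ((codiff g H y l : ℝ) : ℂ)) := by
  have hs1 := star_clm (g := g) (ContinuousLinearMap.fst ℝ ℝ ℝ)
    (F := fun z i j => (F z i j, H z i j))
  have hs2 := star_clm (g := g) (ContinuousLinearMap.snd ℝ ℝ ℝ)
    (F := fun z i j => (F z i j, H z i j))
  have hp : ∀ i j, DifferentiableAt ℝ
      (fun z => star g (fun z i j => (F z i j, H z i j)) z i j) y := by
    intro i j
    have e : (fun z => star g (fun z i j => (F z i j, H z i j)) z i j) =
        fun z => (star g F z i j, star g H z i j) := by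
      ext z
      · exact (congrFun (congrFun (congrFun hs1 z) i) j).symm
      · exact (congrFun (congrFun (congrFun hs2 z) i) j).symm
    rw [e]
    exact (hF i j).prodMk (hH i j)
  have h1 := codiff_clm (g := g) (complexPair c) (F := fun z i j => (F z i j, H z i j)) hp l
  have h2 := codiff_clm (g := g) (ContinuousLinearMap.fst ℝ ℝ ℝ)
    (F := fun z i j => (F z i j, H z i j)) hp l
  have h3 := codiff_clm (g := g) (ContinuousLinearMap.snd ℝ ℝ ℝ)
    (F := fun z i j => (F z i j, H z i j)) hp l
  simp only [complexPair_apply] at h1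
  rw [h1]
  simp only [ContinuousLinearMap.coe_fst', ContinuousLinearMap.coe_snd'] at h2 h3
  rw [← h2, ← h3]

end Pair

/-! ### The theorem in a coordinate system. -/

section Local

/-- For `a = δU`, `b = δ*U`, `F = U`, `H = *U` the two real expressions are `Φ[U]` and `Ψ[U]`. -/
theorem inter2_complexPair (G : Mat) {c : ℂ} (hc : c * c = 1 / 2) (a b : Fin 4 → ℝ)
    (F H : Fin 4 → Fin 4 → ℝ) (k : Fin 4) :
    inter2 G (fun l => c * ((a l : ℂ) - Complex.I * (b l : ℂ)))
      (fun i j => c * ((F i j : ℂ) - Complex.I * (H i j : ℂ))) k =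
      (1 / 2) * (((inter2 G a F k - inter2 G b H k : ℝ) : ℂ)
        + Complex.I * ((-inter2 G a H k - inter2 G b F k : ℝ) : ℂ)) := by
  have h : ∀ m, raise1 G (fun l => c * ((a l : ℂ) - Complex.I * (b l : ℂ))) m =
      c * (((raise1 G a m : ℝ) : ℂ) - Complex.I * ((raise1 G b m : ℝ) : ℂ)) := by
    intro m
    simp only [raise1, Complex.real_smul, smul_eq_mul, Complex.ofReal_sum, Complex.ofReal_mul,
      Finset.mul_sum, ← Finset.sum_sub_distrib]
    exact Finset.sum_congr rfl fun j _ => by ring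
  simp only [inter2, h, Complex.ofReal_sub, Complex.ofReal_neg, Complex.ofReal_sum,
    Complex.ofReal_mul, Finset.mul_sum, ← Finset.sum_sub_distrib, ← Finset.sum_add_distrib,
    ← Finset.sum_neg_distrib]
  refine Finset.sum_congr rfl fun m _ => ?_
  generalize ((raise1 G a m : ℝ) : ℂ) = p
  generalize ((raise1 G b m : ℝ) : ℂ) = q
  linear_combination ((p - Complex.I * q) * (F m k - Complex.I * H m k)) * hc
    + (1 / 2 * q * H m k) * Complex.I_mul_I

variable {g : E4 → Mat} {U A : E4 → Mat} {y : E4}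

/-- The theorem in a coordinate system. -/
theorem killingYano_iff_local (hg : ∀ z, (g z).transpose = g z) (hgd : DiffMat g y)
    (hdet : (g y).det < 0) (hUd : DiffMat U y) (hU : ∀ z i j, U z i j = -U z j i)
    (hn : ∀ᶠ z in nhds y, ((g z)⁻¹ * U z * (g z)⁻¹ * U z).trace = 2)
    (hn' : ∀ᶠ z in nhds y, ((g z)⁻¹ * U z * (g z)⁻¹ * hod (g z) (U z)).trace = 0)
    {φ ψ : E4 → ℝ} (hφ : DifferentiableAt ℝ φ y) (hψ : DifferentiableAt ℝ ψ y)
    (hA : ∀ᶠ z in nhds y, A z = Real.exp (φ z) •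
      (Real.cos (ψ z) • U z + Real.sin (ψ z) • hod (g z) (U z))) :
    (∀ i j k, (1 / 2 : ℝ) * (nabla g (fun z => A z) y i j k + nabla g (fun z => A z) y j i k) = 0) ↔
      (∀ k i j, Sigma g (fun z => U z) y k i j = 0) ∧
      (∀ k, -2 * pd k φ y = Phi g (fun z => U z) y k) ∧
      (∀ k, -2 * pd k ψ y = Psi g (fun z => U z) y k) ∧
      ∀ k, Real.cos (ψ y) * codiff g (fun z => U z) y k
        + Real.sin (ψ y) * codiff g (star g fun z => U z) y k = 0 := by
  set D := nablaMat g U y with hD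
  have hWd : DiffMat (fun z => hod (g z) (U z)) y := DiffMat.hod hg hgd hdet hUd
  have hDW : ∀ k, nablaMat g (fun z => hod (g z) (U z)) y k = hod (g y) (D k) :=
    nablaMat_hod hg hgd hdet hUd (hU y)
  have hDs : ∀ k i j, D k i j = -D k j i := fun k => nablaMat_skew hU k
  have hjet : UnitaryJet (g y) (U y) D := by
    refine ⟨hU y, hDs, hn.self_of_nhds, hn'.self_of_nhds, fun k => ?_, fun k => ?_⟩
    · have h := trace_deriv_eq_zero hg hgd hdet.ne hUd hUd hn k
      have e : ((g y)⁻¹ * D k * (g y)⁻¹ * U y).trace = ((g y)⁻¹ * U y * (g y)⁻¹ * D k).trace := by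
        rw [Matrix.mul_assoc ((g y)⁻¹ * D k), Matrix.trace_mul_comm]
        simp only [Matrix.mul_assoc]
      linarith
    · have h := trace_deriv_eq_zero hg hgd hdet.ne hUd hWd hn' k
      -- The pairing `(F, H) ↦ F·*H` is symmetric, so the two terms of the derivative coincide.
      rw [hDW, trace_hod_comm (hg y) (hDs k) (hU y)] at h
      linarith
  set c : ℂ := 1 / (Real.sqrt 2 : ℂ) with hcdef
  have hc : c * c = 1 / 2 := by
    have h2 : ((Real.sqrt 2 : ℝ) : ℂ) * ((Real.sqrt 2 : ℝ) : ℂ) = 2 := by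
      rw [← Complex.ofReal_mul, Real.mul_self_sqrt (by norm_num)]; norm_num
    rw [hcdef, div_mul_div_comm, h2, one_mul]
  set α := Real.exp (φ y) * Real.cos (ψ y) with hα
  set β := Real.exp (φ y) * Real.sin (ψ y) with hβ
  have hαβ : (α : ℂ) + Complex.I * β ≠ 0 := by
    intro h0
    have h1 := congrArg Complex.re h0
    have h2 := congrArg Complex.im h0
    simp [-Complex.ofReal_mul, hα, hβ, (Real.exp_pos _).ne'] at h1 h2
    have := Real.sin_sq_add_cos_sq (ψ y)
    rw [h1, h2] at this
    norm_num at this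
  have hαd : HasFDerivAt (fun z => Real.exp (φ z) * Real.cos (ψ z)) _ y :=
    hφ.hasFDerivAt.exp.mul hψ.hasFDerivAt.cos
  have hβd : HasFDerivAt (fun z => Real.exp (φ z) * Real.sin (ψ z)) _ y :=
    hφ.hasFDerivAt.exp.mul hψ.hasFDerivAt.sin
  have hαk : ∀ k, pd k (fun z => Real.exp (φ z) * Real.cos (ψ z)) y =
      α * pd k φ y - β * pd k ψ y := by
    intro k
    rw [pd, hαd.fderiv]
    simp [pd, hα, hβ]; ring
  have hβk : ∀ k, pd k (fun z => Real.exp (φ z) * Real.sin (ψ z)) y =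
      β * pd k φ y + α * pd k ψ y := by
    intro k
    rw [pd, hβd.fderiv]
    simp [pd, hα, hβ]; ring
  have hAy : A y = α • U y + β • hod (g y) (U y) := by
    rw [hA.self_of_nhds, smul_add, smul_smul, smul_smul]
  have hApd : ∀ k, pdMat k A y = (α * pd k φ y - β * pd k ψ y) • U y + α • pdMat k U y
      + ((β * pd k φ y + α * pd k ψ y) • hod (g y) (U y)
        + β • pdMat k (fun z => hod (g z) (U z)) y) := by
    intro k
    ext i j
    have e : (fun z => A z i j) =ᶠ[nhds y] fun z =>
        ((Real.exp (φ z) * Real.cos (ψ z)) • U z) i j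
          + ((Real.exp (φ z) * Real.sin (ψ z)) • hod (g z) (U z)) i j := by
      filter_upwards [hA] with z hz
      rw [hz, smul_add, smul_smul, smul_smul]; rfl
    have d1 : DiffMat (fun z => (Real.exp (φ z) * Real.cos (ψ z)) • U z) y :=
      DiffMat.smul hαd.differentiableAt hUd
    have d2 : DiffMat (fun z => (Real.exp (φ z) * Real.sin (ψ z)) • hod (g z) (U z)) y :=
      DiffMat.smul hβd.differentiableAt hWd
    have h1 := congrFun (congrFun (pdMat_smul hαd.differentiableAt hUd k) i) j
    have h2 := congrFun (congrFun (pdMat_smul hβd.differentiableAt hWd k) i) j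
    rw [hαk] at h1
    rw [hβk] at h2
    have h3 : pdMat k A y i j = _ := (pd_congr k e).trans (pd_add k (d1 i j) (d2 i j))
    exact h3.trans (congrArg₂ (· + ·) h1 h2)
  have hT : ∀ k, nablaMat g A y k = (α * pd k φ y - β * pd k ψ y) • U y
      + (β * pd k φ y + α * pd k ψ y) • hod (g y) (U y) + α • D k + β • hod (g y) (D k) := by
    intro k
    rw [← hDW, hD, nablaMat_eq, nablaMat_eq, nablaMat_eq, hApd, hAy]
    simp only [mul_add, add_mul, Matrix.mul_smul, Matrix.smul_mul, smul_sub]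
    abel
  have hstar : star g (fun z => U z) = fun z => hod (g z) (U z) := star_eq_hod hg
  have hstar2 : star g (fun z => hod (g z) (U z)) = fun z => hod (g z) (hod (g z) (U z)) :=
    star_eq_hod hg
  have ha : ∀ l, codiff g (fun z => U z) y l = codiv (g y) (fun k => D k) l :=
    codiff_eq_codiv hg hgd hdet hUd hU
  have hb : ∀ l, codiff g (star g fun z => U z) y l = codiv (g y) (fun k => hod (g y) (D k)) l := by
    intro l
    rw [hstar, codiff_eq_codiv hg hgd hdet hWd (fun z => hod_skew (U z))]
    simp only [hDW]
  have hsd : ∀ z, selfDual g (fun z => U z) z = sdPart c (g z) (U z) := by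
    intro z
    ext i j
    simp only [selfDual, hstar]
    rfl
  have hd : ∀ l, codiff g (selfDual g fun z => U z) y l =
      c * (((codiv (g y) (fun k => D k) l : ℝ) : ℂ)
        - Complex.I * ((codiv (g y) (fun k => hod (g y) (D k)) l : ℝ) : ℂ)) := by
    intro l
    rw [← ha, ← hb]
    refine codiff_complexPair c (fun i j => ?_) (fun i j => ?_) l
    · rw [hstar]; exact hWd i j
    · rw [hstar, hstar2]; exact (DiffMat.hod hg hgd hdet hWd) i j
  have hnab : ∀ k i j, nabla g (selfDual g fun z => U z) y k i j = sdPart c (g y) (D k) i j := by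
    intro k i j
    have h1 := nabla_complexPair (g := g) (F := fun z => U z) (H := star g fun z => U z) c
      hUd (by rw [hstar]; exact hWd) k i j
    refine h1.trans ?_
    rw [sdPart, ← hDW, hstar]
    rfl
  have main := hjet.killingYano_iff (hg y) hdet hαβ (fun k => pd k φ y) (fun k => pd k ψ y) hc hT hd
  have hinter : ∀ k, inter2 (g y) (codiff g (selfDual g fun z => U z) y)
      (sdPart c (g y) (U y)) k = (1 / 2) * (((Phi g (fun z => U z) y k : ℝ) : ℂ)
        + Complex.I * ((Psi g (fun z => U z) y k : ℝ) : ℂ)) := by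
    intro k
    have hW : star g (fun z => U z) y = hod (g y) (U y) := congrFun hstar y
    have h1 := inter2_complexPair (g y) hc (codiff g (fun z => U z) y)
      (codiff g (star g fun z => U z) y) (U y) (star g (fun z => U z) y) k
    simp only [ha, hb, ← hd] at h1
    rw [hW] at h1
    refine h1.trans ?_
    rw [← hW]
    rfl
  have hlam : (∀ k, (((pd k φ y : ℝ) : ℂ) + Complex.I * ((pd k ψ y : ℝ) : ℂ)) =
      -inter2 (g y) (codiff g (selfDual g fun z => U z) y) (sdPart c (g y) (U y)) k) ↔
      (∀ k, -2 * pd k φ y = Phi g (fun z => U z) y k) ∧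
      ∀ k, -2 * pd k ψ y = Psi g (fun z => U z) y k := by
    rw [← forall_and]
    refine forall_congr' fun k => ?_
    rw [hinter]
    constructor
    · intro h
      have h1 := congrArg Complex.re h
      have h2 := congrArg Complex.im h
      simp at h1 h2
      constructor <;> linarith
    · rintro ⟨h1, h2⟩
      rw [← h1, ← h2]
      push_cast
      ring
  have hcod : (∀ l, α * codiv (g y) (fun k => D k) l
        + β * codiv (g y) (fun k => hod (g y) (D k)) l = 0) ↔
      ∀ k, Real.cos (ψ y) * codiff g (fun z => U z) y k
        + Real.sin (ψ y) * codiff g (star g fun z => U z) y k = 0 := by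
    refine forall_congr' fun l => ?_
    rw [ha, hb, hα, hβ, mul_assoc, mul_assoc, ← mul_add,
      mul_eq_zero_iff_left (Real.exp_pos _).ne']
  have hKY : (∀ i j k, (1 / 2 : ℝ) * (nabla g (fun z => A z) y i j k
      + nabla g (fun z => A z) y j i k) = 0) ↔
      ∀ k i j, nablaMat g A y k i j = -nablaMat g A y i k j := by
    refine forall_congr' fun i => forall_congr' fun j => forall_congr' fun k => ?_
    simp only [nablaMat]
    constructor <;> intro h <;> linarith
  rw [hKY, main, hlam, hcod, ← and_assoc, ← and_assoc, ← and_assoc]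
  simp only [Sigma, hnab, hsd]
  simp only [and_assoc]

end Local

/-! ### Norms of the volume element of a time-like plane. -/

section SimpleBivector

variable {G : Mat}

/-- The trace is a multiple of `(τ ∧ σ) ∧ (τ ∧ σ) = 0`. -/
theorem trace_mul_dual_simple (τ σ : Fin 4 → ℝ) :
    ((Matrix.vecMulVec τ σ - Matrix.vecMulVec σ τ) *
      dual (Matrix.vecMulVec τ σ - Matrix.vecMulVec σ τ)).trace = 0 := by
  rw [dual_eq]
  simp only [Matrix.trace, Matrix.diag_apply, Matrix.mul_apply, Fin.sum_univ_four,
    Matrix.smul_apply, Matrix.sub_apply, Matrix.vecMulVec_apply, Matrix.of_apply,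
    Matrix.cons_val, smul_eq_mul]
  ring

/-- The norm identities of the volume form of a time-like plane. -/
theorem trace_simple_unitary (hG : G.transpose = G) (hdet : G.det < 0) {U : Mat}
    {τ σ : Fin 4 → ℝ} (hτ : τ ⬝ᵥ G.mulVec τ = -1) (hσ : σ ⬝ᵥ G.mulVec σ = 1)
    (hτσ : τ ⬝ᵥ G.mulVec σ = 0)
    (hU : ∀ i j, U i j = G.mulVec τ i * G.mulVec σ j - G.mulVec σ i * G.mulVec τ j) :
    (G⁻¹ * U * G⁻¹ * U).trace = 2 ∧ (G⁻¹ * U * G⁻¹ * hod G U).trace = 0 := by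
  have hu : IsUnit G.det := hdet.ne.isUnit
  have hU' : U = G * (Matrix.vecMulVec τ σ - Matrix.vecMulVec σ τ) * G := by
    rw [mul_sub, sub_mul, Matrix.mul_vecMulVec, Matrix.mul_vecMulVec, Matrix.vecMulVec_mul,
      Matrix.vecMulVec_mul, ← Matrix.mulVec_transpose, ← Matrix.mulVec_transpose, hG]
    ext i j
    simp [hU, Matrix.vecMulVec_apply]
  have hP : G⁻¹ * U * G⁻¹ = Matrix.vecMulVec τ σ - Matrix.vecMulVec σ τ := by
    rw [hU', Matrix.mul_assoc G, Matrix.nonsing_inv_mul_cancel_left _ _ hu,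
      Matrix.mul_nonsing_inv_cancel_right _ _ hu]
  constructor
  · have hτσ' : σ ⬝ᵥ G.mulVec τ = 0 := by
      rw [← hτσ, dotProduct_comm, ← Matrix.vecMul_transpose, hG, Matrix.dotProduct_mulVec]
    have hUv : U = Matrix.vecMulVec (G.mulVec τ) (G.mulVec σ)
        - Matrix.vecMulVec (G.mulVec σ) (G.mulVec τ) := by
      ext i j; simp [hU, Matrix.vecMulVec_apply]
    rw [hP, hUv]
    simp only [sub_mul, mul_sub, Matrix.vecMulVec_mul_vecMulVec, Matrix.trace_sub,
      Matrix.trace_vecMulVec, hτ, hσ, hτσ, hτσ']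
    norm_num
    rw [hσ, hτ]
    norm_num
  · rw [hod, Matrix.mul_smul, Matrix.trace_smul, hP, trace_mul_dual_simple, smul_zero]

end SimpleBivector

/-! ### Components in smooth charts. -/

section Charts

variable {M : Type*} [TopologicalSpace M] [ChartedSpace E4 M]
  {e : OpenPartialHomeomorph M E4}

theorem mdifferentiable_of_mem_maximalAtlas (he : e ∈ IsManifold.maximalAtlas (𝓡 4) ∞ M) :
    e.MDifferentiable (𝓡 4) (𝓡 4) :=
  ⟨(contMDiffOn_of_mem_maximalAtlas he).mdifferentiableOn (by simp),
    (contMDiffOn_symm_of_mem_maximalAtlas he).mdifferentiableOn (by simp)⟩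

theorem differentiableAt_comp_symm (he : e ∈ IsManifold.maximalAtlas (𝓡 4) ∞ M) {z : E4}
    (hz : z ∈ e.target) {f : M → ℝ} (hf : ContMDiff (𝓡 4) 𝓘(ℝ) ∞ f) :
    DifferentiableAt ℝ (fun z => f (e.symm z)) z := by
  have hs : ContMDiffAt (𝓡 4) (𝓡 4) ∞ e.symm z :=
    (contMDiffOn_symm_of_mem_maximalAtlas he).contMDiffAt (e.open_target.mem_nhds hz)
  exact (hf.contMDiffAt.comp z hs).contDiffAt.differentiableAt (by simp)

theorem exists_coordBasis (he : e ∈ IsManifold.maximalAtlas (𝓡 4) ∞ M) {z : E4}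
    (hz : z ∈ e.target) : ∃ c : Module.Basis (Fin 4) ℝ (TangentSpace (𝓡 4) (e.symm z)),
      ∀ i, c i = coordVec e z i := by
  have hd := (mdifferentiable_of_mem_maximalAtlas he).symm
  let L : E4 ≃L[ℝ] TangentSpace (𝓡 4) (e.symm z) := hd.mfderiv hz
  refine ⟨(EuclideanSpace.basisFun (Fin 4) ℝ).toBasis.map L.toLinearEquiv, fun i => ?_⟩
  rw [Module.Basis.map_apply, OrthonormalBasis.coe_toBasis, EuclideanSpace.basisFun_apply]
  rfl

variable [IsManifold (𝓡 4) ∞ M]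

/-- Order one suffices, since only first derivatives of components occur. -/
theorem contMDiffAt_coordVec (he : e ∈ IsManifold.maximalAtlas (𝓡 4) ∞ M) {z : E4}
    (hz : z ∈ e.target) (i : Fin 4) :
    ContMDiffAt (𝓡 4) ((𝓡 4).prod 𝓘(ℝ, E4)) 1
      (fun z => (Bundle.TotalSpace.mk' E4 (e.symm z) (coordVec e z i) :
        Bundle.TotalSpace E4 (TangentSpace (𝓡 4) : M → Type _))) z := by
  have hs : ContMDiffAt (𝓡 4) (𝓡 4) ∞ e.symm z :=
    (contMDiffOn_symm_of_mem_maximalAtlas he).contMDiffAt (e.open_target.mem_nhds hz)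
  have hϕ := hs.mfderiv_const (m := 1) (by
    norm_cast)
  refine ContMDiffAt.clm_apply_of_inCoordinates (IM := 𝓡 4) (IB₁ := 𝓡 4) (IB₂ := 𝓡 4)
    (b₁ := id) (b₂ := e.symm)
    (E₁ := (TangentSpace (𝓡 4) : E4 → Type _)) (E₂ := (TangentSpace (𝓡 4) : M → Type _))
    (ϕ := fun z => mfderiv (𝓡 4) (𝓡 4) e.symm z)
    (v := fun _ => (EuclideanSpace.single i (1 : ℝ) : E4)) hϕ ?_ (hs.of_le (by simp))
  exact (contMDiffAt_vectorSpace_iff_contDiffAt (V := fun _ : E4 =>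
    (EuclideanSpace.single i (1 : ℝ) : E4))).2 contDiffAt_const

theorem differentiableAt_comp (he : e ∈ IsManifold.maximalAtlas (𝓡 4) ∞ M) {z : E4}
    (hz : z ∈ e.target)
    {val : (p : M) → TangentSpace (𝓡 4) p →L[ℝ] TangentSpace (𝓡 4) p →L[ℝ] ℝ}
    (hval : ContMDiff (𝓡 4) ((𝓡 4).prod 𝓘(ℝ, E4 →L[ℝ] E4 →L[ℝ] ℝ)) ∞
      (fun p => Bundle.TotalSpace.mk' (E4 →L[ℝ] E4 →L[ℝ] ℝ)
        (E := fun p => TangentSpace (𝓡 4) p →L[ℝ] TangentSpace (𝓡 4) p →L[ℝ] ℝ) p (val p)))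
    (i j : Fin 4) :
    DifferentiableAt ℝ (fun z => val (e.symm z) (coordVec e z i) (coordVec e z j)) z := by
  have hs : ContMDiffAt (𝓡 4) (𝓡 4) 1 e.symm z :=
    ((contMDiffOn_symm_of_mem_maximalAtlas he).contMDiffAt
      (e.open_target.mem_nhds hz)).of_le (by simp)
  have : ContMDiffAt (𝓡 4) ((𝓡 4).prod 𝓘(ℝ)) 1
      (fun z => Bundle.TotalSpace.mk' ℝ (E := Bundle.Trivial M ℝ) (e.symm z)
        (val (e.symm z) (coordVec e z i) (coordVec e z j))) z := by
    apply ContMDiffAt.clm_bundle_apply₂ (F₁ := E4) (F₂ := E4)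
    · exact ContMDiffAt.comp z ((hval.of_le (by simp)).contMDiffAt) hs
    · exact contMDiffAt_coordVec he hz i
    · exact contMDiffAt_coordVec he hz j
  simp only [Bundle.contMDiffAt_totalSpace] at this
  exact this.2.contDiffAt.differentiableAt (by simp)

/-- No condition `z ∈ e.target` is needed: a symmetric form is symmetric on whatever vectors
`coordVec` returns. The local theorem asks for this symmetry at every `z`. -/
theorem LorentzMetric.comp_transpose (g : LorentzMetric M) (e : OpenPartialHomeomorph M E4)
    (z : E4) : (g.comp e z).transpose = g.comp e z := by
  ext i j
  exact g.symm _ _ _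

/-- Passing from an orthonormal basis to the coordinate basis by `B` gives the determinant `-(det
B)²`. -/
theorem LorentzMetric.comp_det_neg (g : LorentzMetric M)
    (he : e ∈ IsManifold.maximalAtlas (𝓡 4) ∞ M) {z : E4} (hz : z ∈ e.target) :
    (g.comp e z).det < 0 := by
  obtain ⟨c, hc⟩ := exists_coordBasis he hz
  obtain ⟨b, hb⟩ := g.signature (e.symm z)
  set B : Mat := b.toMatrix c with hB
  have hm : g.comp e z = B.transpose * Matrix.diagonal ![-1, 1, 1, 1] * B := by
    ext i j
    have hci : ∀ i, coordVec e z i = ∑ a, B a i • b a := fun i => by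
      rw [← hc, hB, b.sum_toMatrix_smul_self]
    simp only [LorentzMetric.comp, Matrix.of_apply]
    rw [hci i, hci j]
    simp only [Matrix.mul_apply, Matrix.diagonal_apply, Matrix.transpose_apply,
      Fin.sum_univ_four]
    simp [hb]
  have hBdet : B.det ≠ 0 := by
    have h : B * c.toMatrix b = 1 := b.toMatrix_mul_toMatrix_flip c
    intro h0
    have := congrArg Matrix.det h
    rw [Matrix.det_mul, h0, zero_mul, Matrix.det_one] at this
    exact zero_ne_one this
  rw [hm, Matrix.det_mul, Matrix.det_mul, Matrix.det_transpose, Matrix.det_diagonal]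
  simp only [Fin.prod_univ_four, Matrix.cons_val]
  nlinarith [mul_self_pos.2 hBdet]

theorem IsCanonicalUnitary.trace_comp {g : LorentzMetric M} {U : TwoForm M}
    (h : IsCanonicalUnitary g U) (he : e ∈ IsManifold.maximalAtlas (𝓡 4) ∞ M) {z : E4}
    (hz : z ∈ e.target) {F : Mat} (hF : F = U.comp e z) :
    ((g.comp e z)⁻¹ * F * (g.comp e z)⁻¹ * F).trace = 2 ∧
      ((g.comp e z)⁻¹ * F * (g.comp e z)⁻¹ * hod (g.comp e z) F).trace = 0 := by
  obtain ⟨c, hc⟩ := exists_coordBasis he hz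
  obtain ⟨t, s, htt, hss, hts, hU⟩ := h (e.symm z)
  have hlow : ∀ (v : TangentSpace (𝓡 4) (e.symm z)) i,
      (g.comp e z).mulVec (c.repr v) i = g.val (e.symm z) v (coordVec e z i) := by
    intro v i
    conv_rhs => rw [← c.sum_repr v]
    simp only [map_sum, map_smul, _root_.sum_apply, _root_.smul_apply,
      smul_eq_mul, Matrix.mulVec, dotProduct, LorentzMetric.comp, Matrix.of_apply, hc]
    exact Finset.sum_congr rfl fun m _ => by rw [g.symm, mul_comm]
  have hpair : ∀ v w : TangentSpace (𝓡 4) (e.symm z),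
      (c.repr v) ⬝ᵥ (g.comp e z).mulVec (c.repr w) = g.val (e.symm z) v w := by
    intro v w
    rw [g.symm]
    conv_rhs => rw [← c.sum_repr v]
    simp only [dotProduct, hlow, map_sum, map_smul, smul_eq_mul, hc]
  refine trace_simple_unitary (g.comp_transpose e z) (g.comp_det_neg he hz) (τ := c.repr t)
    (σ := c.repr s) ?_ ?_ ?_ fun i j => ?_
  · rw [hpair, htt]
  · rw [hpair, hss]
  · rw [hpair, hts]
  · rw [hlow, hlow, hlow, hlow, hF]
    exact hU _ _

end Charts

end Spacetime

end

/-! ### From charts to the manifold. -/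

theorem mainTheorem5 {M : Type*} [TopologicalSpace M] [ChartedSpace Spacetime.E4 M]
    [IsManifold (𝓡 4) ∞ M] (g : Spacetime.LorentzMetric M) (O : Spacetime.OrientedAtlas M)
    (A U : Spacetime.TwoForm M) (φ ψ : M → ℝ)
    (hA : Spacetime.HasCanonicalElements g O A U φ ψ) :
    Spacetime.IsKillingYano g O A ↔
      Spacetime.SigmaVanishes g O U ∧
      Spacetime.PhiEquation g O U φ ∧
      Spacetime.PsiEquation g O U ψ ∧
      Spacetime.CodiffEquation g O U ψ := by
  -- The equivalence holds separately at each point of each chart, so it only remains to distribute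
  -- the quantifiers.
  have local_iff : ∀ e ∈ O.charts, ∀ y ∈ e.target, _ := fun e he y hy => by
    have hem := O.smooth he
    have hnhds := e.open_target.mem_nhds hy
    have hg := g.comp_transpose e
    exact Spacetime.killingYano_iff_local (g := g.comp e) (U := fun z => U.comp e z)
      (A := fun z => A.comp e z) (y := y) hg
      (Spacetime.differentiableAt_comp hem hy g.contMDiff) (g.comp_det_neg hem hy)
      (Spacetime.differentiableAt_comp hem hy U.contMDiff) (fun z i j => U.skew _ _ _)
      (by filter_upwards [hnhds] with z hz using (hA.unitary.trace_comp hem hz rfl).1)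
      (by filter_upwards [hnhds] with z hz using (hA.unitary.trace_comp hem hz rfl).2)
      (Spacetime.differentiableAt_comp_symm hem hy hA.smooth_phi)
      (Spacetime.differentiableAt_comp_symm hem hy hA.smooth_psi)
      (by
        filter_upwards [hnhds] with z hz
        ext i j
        have h := hA.eq e he z hz i j
        rw [Spacetime.star_eq_hod hg (F := fun z => U.comp e z)] at h
        exact h)
  constructor
  · intro hK
    have h := fun e he y hy => (local_iff e he y hy).1 (hK e he y hy)
    exact ⟨fun e he y hy => (h e he y hy).1, fun e he y hy => (h e he y hy).2.1,
      fun e he y hy => (h e he y hy).2.2.1, fun e he y hy => (h e he y hy).2.2.2⟩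
  · rintro ⟨h1, h2, h3, h4⟩ e he y hy
    exact (local_iff e he y hy).2 ⟨h1 e he y hy, h2 e he y hy, h3 e he y hy, h4 e he y hy⟩
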